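/- Let $n\ge 1$ and let $\Omega\subset\mathbb C^n$ be a bounded domain that is biholomorphic to a ball in $\mathbb C^n$. Let $K(z,t)$ be the Bergman kernel of $\Omega$, i.e. the reproducing kernel of the Hilbert space of holomorphic functions on $\Omega$ that are square integrable with respect to Lebesgue measure, and let $g_{\alpha\bar\beta}(p)=\frac{\partial^2}{\partial z_\alpha\partial\bar z_\beta}\big|_{z=p}\log K(z,z)$ be its Bergman metric, with $g^{\bar j\alpha}(p)$ the entries of the inverse of the matrix $[g_{\alpha\bar j}(p)]$. The Bergman representative coordinate $T=(w_1,\dots,w_n)$ relative to $p\in\Omega$ is $$w_\alpha(z)=\sum_{j=1}^n g^{\bar j\alpha}(p)\left(K(z,p)^{-1}\,\frac{\partial}{\partial \bar t_j}\Big|_{t=p}K(z,t)-\frac{\partial}{\partial\bar t_j}\Big|_{t=p}\log K(t,t)\right),\qquad \alpha=1,\dots,n.$$ Assume that there are a nonempty open set $U\subset\Omega$ and finite constants $\mathcal C>0$, $C>0$ such that $$\left|\frac{\partial}{\partial z_j}K(z,p)\right|\le \mathcal C\,|K(z,p)|\quad (j=1,\dots,n)\qquad\text{and}\qquad |K(z,p)|\ge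 C$$ for all $z\in\Omega$ and all $p\in U$. Then for every $p\in U$ the Bergman representative coordinate $T$ relative to $p$ maps $\Omega$ biholomorphically onto the ball $$\mathcal B=\Big\{w\in\mathbb C^n:\ \sum_{\alpha,\beta=1}^n w_\alpha\, g_{\alpha\bar\beta}(p)\,\overline{w_\beta}<n+1\Big\},$$ and its inverse $T^{-1}:\mathcal B\to\Omega$ extends continuously to the closure $\overline{\mathcal B}$. In particular, $\partial\Omega$ is locally connected. -/

import Mathlib

noncomputable section

/-- Square integrable holomorphic functions on the open set `Ω ⊆ ℂⁿ` (elements of the Bergman space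
`A²(Ω)`), with respect to Lebesgue measure; only the values on `Ω` matter. -/
def MemBergmanSpace {n : ℕ} (Ω : Set (Fin n → ℂ)) (f : (Fin n → ℂ) → ℂ) : Prop :=
  DifferentiableOn ℂ f Ω ∧
    MeasureTheory.MemLp f 2 (MeasureTheory.volume.restrict Ω)

/-- `k ∈ A²(Ω)` represents evaluation at `p`: `f(p) = ∫_Ω f(z) conj(k(z)) dV(z)` for all
`f ∈ A²(Ω)`. -/
def IsReproducingAt {n : ℕ} (Ω : Set (Fin n → ℂ)) (p : Fin n → ℂ) (k : (Fin n → ℂ) → ℂ) : Prop :=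
  MemBergmanSpace Ω k ∧
    ∀ f, MemBergmanSpace Ω f → f p = ∫ z in Ω, f z * starRingEnd ℂ (k z)

open Classical in
/-- The Bergman kernel `K(z, p)` of `Ω`: for `p ∈ Ω`, the function `K(·, p)` is the element of
`A²(Ω)` (unique on `Ω`) that represents evaluation at `p`. -/
def bergmanKernel {n : ℕ} (Ω : Set (Fin n → ℂ)) (z p : Fin n → ℂ) : ℂ :=
  if h : ∃ k, IsReproducingAt Ω p k then h.choose z else 0

/-- The Wirtinger derivative `∂f/∂z_j = (∂f/∂x_j - i ∂f/∂y_j) / 2`. -/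
def wirtinger {n : ℕ} (j : Fin n) (f : (Fin n → ℂ) → ℂ) (z : Fin n → ℂ) : ℂ :=
  (fderiv ℝ f z (Pi.single j 1) - Complex.I * fderiv ℝ f z (Pi.single j Complex.I)) / 2

/-- The Wirtinger derivative `∂f/∂z̄_j = (∂f/∂x_j + i ∂f/∂y_j) / 2`. -/
def wirtingerBar {n : ℕ} (j : Fin n) (f : (Fin n → ℂ) → ℂ) (z : Fin n → ℂ) : ℂ :=
  (fderiv ℝ f z (Pi.single j 1) + Complex.I * fderiv ℝ f z (Pi.single j Complex.I)) / 2

/-- The function `t ↦ log K(t, t)` (recall that `K(t, t)` is a positive real number on a bounded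
domain). -/
def logBergmanDiag {n : ℕ} (Ω : Set (Fin n → ℂ)) (t : Fin n → ℂ) : ℂ :=
  (Real.log (bergmanKernel Ω t t).re : ℂ)

/-- The matrix `[g_{α β̄}(p)]`, `g_{α β̄} = ∂² log K(z, z) / ∂z_α ∂z̄_β`, of the Bergman metric. -/
def bergmanMetric {n : ℕ} (Ω : Set (Fin n → ℂ)) (p : Fin n → ℂ) : Matrix (Fin n) (Fin n) ℂ :=
  Matrix.of fun α β => wirtinger α (wirtingerBar β (logBergmanDiag Ω)) p

/-- The Bergman representative coordinate `T = (w_1, …, w_n)` relative to `p`: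
`w_α(z) = ∑_j g^{j̄ α}(p) (K(z,p)⁻¹ ∂/∂t̄_j|_{t=p} K(z,t) - ∂/∂t̄_j|_{t=p} log K(t,t))`,
where `g^{j̄ α}` is the `(j, α)` entry of the inverse of `[g_{α j̄}]`. -/
def bergmanRep {n : ℕ} (Ω : Set (Fin n → ℂ)) (p z : Fin n → ℂ) : Fin n → ℂ := fun α =>
  ∑ j, (bergmanMetric Ω p)⁻¹ j α *
    ((bergmanKernel Ω z p)⁻¹ * wirtingerBar j (fun t => bergmanKernel Ω z t) p
      - wirtingerBar j (logBergmanDiag Ω) p)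

/-- The Euclidean ball of center `a` and radius `r` in `ℂⁿ` (`Fin n → ℂ` itself carries the
sup norm, which has the same topology, bounded sets and differentiable maps). -/
def euclideanBall {n : ℕ} (a : Fin n → ℂ) (r : ℝ) : Set (Fin n → ℂ) :=
  {z | ∑ i, ‖z i - a i‖ ^ 2 < r ^ 2}

/-- The ball `{w : ∑ w_α g_{α β̄}(p) conj(w_β) < n + 1}` in the inner product that the Bergman
metric induces at `p`. -/
def bergmanBall {n : ℕ} (Ω : Set (Fin n → ℂ)) (p : Fin n → ℂ) : Set (Fin n → ℂ) :=
  {w | (∑ α, ∑ β, w α * bergmanMetric Ω p α β * starRingEnd ℂ (w β)).re < (n : ℝ) + 1}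

/-- `F` maps `A` biholomorphically onto `B`, with inverse `G`. -/
structure IsBiholomorphism {n : ℕ} (F G : (Fin n → ℂ) → (Fin n → ℂ)) (A B : Set (Fin n → ℂ)) :
    Prop where
  mapsTo : Set.MapsTo F A B
  mapsTo_inv : Set.MapsTo G B A
  invOn : Set.InvOn G F A B
  holomorphic : DifferentiableOn ℂ F A
  holomorphic_inv : DifferentiableOn ℂ G B

/-- Condition (B) for `Ω` and the (nonempty) open set `U ⊆ Ω`: there is a finite constant `C > 0`
with `|∂K(z, p)/∂z_j| ≤ C |K(z, p)|` for all `j`, all `z ∈ Ω` and all `p ∈ U`. -/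
def ConditionB {n : ℕ} (Ω U : Set (Fin n → ℂ)) : Prop :=
  IsOpen U ∧ U.Nonempty ∧ U ⊆ Ω ∧ ∃ C : ℝ, 0 < C ∧
    ∀ j : Fin n, ∀ z ∈ Ω, ∀ p ∈ U,
      ‖wirtinger j (fun ζ => bergmanKernel Ω ζ p) z‖ ≤ C * ‖bergmanKernel Ω z p‖

end

open MeasureTheory Metric Set Filter Topology
open scoped Matrix

/-!
Let `F : Ω → 𝔹` be a biholomorphism onto the unit ball, with complex Jacobian `J`. The mean value
property computes the Bergman kernel of `𝔹` at the center; the automorphisms of `𝔹` carry it to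
every other point, and the transformation law of the kernel then gives
`K(z, t) = vol(𝔹)⁻¹ J(z) conj(J(t)) (1 - ⟨F z, F t⟩)^(-(n + 1))`.
If `F p = 0`, the Bergman metric at `p` is `n + 1` times the pullback of the Euclidean metric under
`F'(p)`, and the representative coordinate relative to `p` is `F'(p)⁻¹ ∘ F`.

For boundary regularity, condition (B) bounds the logarithmic derivatives of `K(·, p)` and
`K(·, t)`. Their difference is `(n + 1) ⟨∂ⱼF(z), F t⟩ / (1 - ⟨F z, F t⟩)`, so letting `F t` be a
small multiple of each basis vector bounds `F'`. The lower bound on `|K(·, p)|` bounds `|J|` away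
from `0`. Hence the derivative of `F⁻¹` is bounded by Cramer's rule, and `F⁻¹` is Lipschitz on the
convex set `𝔹`, so it extends to the closed ball and maps the sphere onto the boundary of `Ω`.
-/

/-! ### Holomorphic functions of several complex variables -/

section SeveralComplexVariables

variable {E F : Type*} [NormedAddCommGroup E] [NormedSpace ℂ E] [NormedAddCommGroup F]
  [NormedSpace ℂ F] {f : E → F} {Ω : Set E} {v z : E} {r M : ℝ}

theorem norm_fderiv_le_of_forall_mem_ball_norm_le (hr : 0 < r)
    (hf : DifferentiableOn ℂ f (ball z r)) (hM : ∀ w ∈ ball z r, ‖f w‖ ≤ M) :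
    ‖fderiv ℂ f z‖ ≤ 2 * M / r := by
  refine Complex.norm_fderiv_le_div_of_mapsTo_ball hf (fun w hw => ?_) hr
  rw [mem_closedBall, dist_eq_norm, two_mul]
  exact (norm_sub_le _ _).trans (add_le_add (hM w hw) (hM z (mem_ball_self hr)))

theorem fderiv_apply_eq_circleIntegral [CompleteSpace F] (hΩ : IsOpen Ω)
    (hf : DifferentiableOn ℂ f Ω) (hr : 0 < r) (hz : ∀ t : ℂ, ‖t‖ ≤ r → z + t • v ∈ Ω) :
    fderiv ℂ f z v =
      (2 * Real.pi * Complex.I : ℂ)⁻¹ • ∮ t in C(0, r), (1 / t ^ 2) • f (z + t • v) := by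
  have hderiv : HasDerivAt (fun t : ℂ => f (z + t • v)) (fderiv ℂ f z v) 0 := by
    have hline : HasDerivAt (fun t : ℂ => z + t • v) v 0 := by
      simpa using ((hasDerivAt_id (0 : ℂ)).smul_const v).const_add z
    have hfz : HasFDerivAt f (fderiv ℂ f (z + (0 : ℂ) • v)) (z + (0 : ℂ) • v) :=
      (hf.differentiableAt (hΩ.mem_nhds (hz 0 (by simpa using hr.le)))).hasFDerivAt
    simpa [Function.comp_def] using hfz.comp_hasDerivAt (0 : ℂ) hline
  have hdisc : DifferentiableOn ℂ (fun t : ℂ => f (z + t • v)) (closedBall 0 r) :=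
    hf.comp (by fun_prop) fun t ht => hz t (mem_closedBall_zero_iff.1 ht)
  have hcauchy := hdisc.deriv_eq_smul_circleIntegral hr
  simp only [sub_zero] at hcauchy
  rw [hcauchy, hderiv.deriv, inv_smul_smul₀ Complex.two_pi_I_ne_zero]

theorem differentiableAt_intervalIntegral_smul_comp_add [FiniteDimensional ℂ E]
    [FiniteDimensional ℂ F] {a b : ℝ} {c : ℝ → ℂ} {γ : ℝ → E} {ρ : ℝ} (hr : 0 < r)
    (hc : Continuous c) (hγ : Continuous γ) (hγρ : ∀ θ, ‖γ θ‖ ≤ ρ)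
    (hf : DifferentiableOn ℂ f (ball z (2 * r + ρ)))
    (hM : ∀ w ∈ ball z (2 * r + ρ), ‖f w‖ ≤ M) :
    DifferentiableAt ℂ (fun w => ∫ θ in a..b, c θ • f (w + γ θ)) z := by
  have := FiniteDimensional.proper ℂ E
  have := FiniteDimensional.proper ℂ (E →L[ℂ] F)
  borelize E
  borelize (E →L[ℂ] F)
  have hball : ∀ w ∈ ball z r, ∀ θ, ball (w + γ θ) r ⊆ ball z (2 * r + ρ) := fun w hw θ => by
    refine ball_subset_ball' ?_
    have hdist : dist (w + γ θ) z ≤ dist w z + ‖γ θ‖ := by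
      simpa [add_comm] using dist_triangle (w + γ θ) w z
    linarith [mem_ball.1 hw, hγρ θ]
  have hmem : ∀ w ∈ ball z r, ∀ θ, w + γ θ ∈ ball z (2 * r + ρ) :=
    fun w hw θ => hball w hw θ (mem_ball_self hr)
  have hcont : ∀ w ∈ ball z r, Continuous fun θ => c θ • f (w + γ θ) := fun w hw =>
    hc.smul (hf.continuousOn.comp_continuous (continuous_const.add hγ) (hmem w hw))
  have hmeas : Measurable fun θ => fderiv ℂ f (z + γ θ) :=
    (measurable_fderiv ℂ f).comp (continuous_const.add hγ).measurable
  refine (intervalIntegral.hasFDerivAt_integral_of_dominated_of_fderiv_le (𝕜 := ℂ)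
    (F' := fun w θ => c θ • fderiv ℂ f (w + γ θ)) (bound := fun θ => ‖c θ‖ * (2 * M / r))
    (ball_mem_nhds z hr) ?_ ((hcont z (mem_ball_self hr)).intervalIntegrable _ _)
    (hc.aestronglyMeasurable.smul hmeas.aestronglyMeasurable) ?_
    ((hc.norm.mul continuous_const).intervalIntegrable _ _) ?_).differentiableAt
  · filter_upwards [ball_mem_nhds z hr] with w hw
    exact (hcont w hw).aestronglyMeasurable
  · refine Eventually.of_forall fun θ _ w hw => ?_
    rw [norm_smul]
    gcongr
    exact norm_fderiv_le_of_forall_mem_ball_norm_le hr (hf.mono (hball w hw θ))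
      fun u hu => hM u (hball w hw θ hu)
  · refine Eventually.of_forall fun θ _ w hw => ?_
    have hfw := (hf.differentiableAt (isOpen_ball.mem_nhds (hmem w hw θ))).hasFDerivAt
    simpa only [Function.comp_def, ContinuousLinearMap.comp_id, id, Pi.smul_def] using
      (hfw.comp w ((hasFDerivAt_id w).add_const (γ θ))).const_smul (c θ)

theorem differentiableOn_fderiv_apply [FiniteDimensional ℂ E] [FiniteDimensional ℂ F]
    (hΩ : IsOpen Ω) (hf : DifferentiableOn ℂ f Ω) (v : E) :
    DifferentiableOn ℂ (fun z => fderiv ℂ f z v) Ω := by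
  have := FiniteDimensional.complete ℂ F
  intro z hz
  obtain ⟨R, hR, hball⟩ : ∃ R > 0, ball z R ⊆ {w ∈ Ω | ‖f w‖ ≤ ‖f z‖ + 1} := by
    refine Metric.mem_nhds_iff.1 ?_
    filter_upwards [hΩ.mem_nhds hz,
      (hf.continuousOn.continuousAt (hΩ.mem_nhds hz)).norm.eventually_lt_const (lt_add_one _)]
      with w hw hfw using ⟨hw, hfw.le⟩
  obtain ⟨δ, hδ, hδv⟩ : ∃ δ > 0, δ * ‖v‖ ≤ R / 3 :=
    ⟨R / 3 / (‖v‖ + 1), by positivity, by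
      rw [div_mul_eq_mul_div, div_le_iff₀ (by positivity)]; gcongr; linarith⟩
  have hsmul : ∀ t : ℂ, ‖t‖ ≤ δ → ‖t • v‖ ≤ R / 3 := fun t ht => by
    rw [norm_smul]; exact (mul_le_mul_of_nonneg_right ht (norm_nonneg v)).trans hδv
  have hcircle : ∀ θ, ‖circleMap 0 δ θ‖ = δ := fun θ => by simp [abs_of_pos hδ]
  have hR3 : 2 * (R / 3) + R / 3 = R := by ring
  have hc : Continuous fun θ => deriv (circleMap 0 δ) θ * (1 / circleMap 0 δ θ ^ 2) := by
    have hne : ∀ θ, circleMap 0 δ θ ^ 2 ≠ 0 := fun θ => by simp [hδ.ne']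
    simp only [deriv_circleMap]
    fun_prop (disch := assumption)
  have hdiff := (differentiableAt_intervalIntegral_smul_comp_add (a := 0) (b := 2 * Real.pi)
    (γ := fun θ => circleMap 0 δ θ • v) (ρ := R / 3) (by positivity : 0 < R / 3) hc
    (by fun_prop) (fun θ => hsmul _ (hcircle θ).le)
    (hf.mono fun w hw => (hball (hR3 ▸ hw)).1) fun w hw => (hball (hR3 ▸ hw)).2).const_smul
    (2 * Real.pi * Complex.I : ℂ)⁻¹
  refine (hdiff.congr_of_eventuallyEq ?_).differentiableWithinAt
  filter_upwards [ball_mem_nhds z (by positivity : 0 < R / 3)] with w hw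
  have hdisc : ∀ t : ℂ, ‖t‖ ≤ δ → w + t • v ∈ Ω := fun t ht => by
    refine (hball (mem_ball.2 ?_)).1
    have hdist : dist (w + t • v) z ≤ dist w z + ‖t • v‖ := by
      simpa [add_comm] using dist_triangle (w + t • v) w z
    linarith [mem_ball.1 hw, hsmul t ht]
  rw [fderiv_apply_eq_circleIntegral hΩ hf hδ hdisc]
  simp only [circleIntegral, smul_smul, Pi.smul_apply]

end SeveralComplexVariables

/-! ### The mean value property on balanced sets -/

section Balanced

variable {E F : Type*} [NormedAddCommGroup E] [NormedSpace ℂ E] [NormedAddCommGroup F]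
  [NormedSpace ℂ F] {B : Set E} {f : E → F}

theorem circleAverage_smul_of_balanced [CompleteSpace F] (hB : Balanced ℂ B)
    (hf : DifferentiableOn ℂ f B) {z : E} (hz : z ∈ B) :
    Real.circleAverage (fun c => f (c • z)) 0 1 = f 0 := by
  have hdisc : DiffContOnCl ℂ (fun c : ℂ => f (c • z)) (ball 0 |1|) := by
    refine DifferentiableOn.diffContOnCl ?_
    rw [abs_one, closure_ball _ one_ne_zero]
    exact hf.comp (by fun_prop) fun c hc => hB.smul_mem (mem_closedBall_zero_iff.1 hc) hz
  simpa using hdisc.circleAverage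

variable [FiniteDimensional ℂ E]

theorem abs_det_restrictScalars (L : E →L[ℂ] E) : |(L.restrictScalars ℝ).det| = ‖L.det‖ ^ 2 := by
  have hdet : (L.restrictScalars ℝ).det = Complex.normSq L.det := by
    rw [ContinuousLinearMap.det, ContinuousLinearMap.det, ← Algebra.norm_complex_apply,
      ← LinearMap.det_restrictScalars]
    rfl
  rw [hdet, abs_of_nonneg (Complex.normSq_nonneg _), Complex.normSq_eq_norm_sq]

variable [MeasurableSpace E] [BorelSpace E] {μ : Measure E} [μ.IsAddHaarMeasure]

theorem measurePreserving_smul_of_norm_eq_one {c : ℂ} (hc : ‖c‖ = 1) :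
    MeasurePreserving (fun z : E => c • z) μ μ := by
  have := FiniteDimensional.complexToReal E
  let L : E →L[ℂ] E := c • ContinuousLinearMap.id ℂ E
  have hdet : |LinearMap.det ((L.restrictScalars ℝ : E →L[ℝ] E) : E →ₗ[ℝ] E)| = 1 := by
    have hL : L.det = c ^ Module.finrank ℂ E := by
      simp [L, ContinuousLinearMap.det, LinearMap.det_smul]
    have := abs_det_restrictScalars L
    rwa [hL, norm_pow, hc, one_pow, one_pow] at this
  refine ⟨by fun_prop, ?_⟩
  have hmap := Measure.map_linearMap_addHaar_eq_smul_addHaar μ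
    (f := ((L.restrictScalars ℝ : E →L[ℝ] E) : E →ₗ[ℝ] E))
    (abs_ne_zero.1 (hdet ▸ one_ne_zero))
  rwa [abs_inv, hdet, inv_one, ENNReal.ofReal_one, one_smul] at hmap

theorem measurePreserving_smul_restrict_of_balanced (hB : Balanced ℂ B) {c : ℂ} (hc : ‖c‖ = 1) :
    MeasurePreserving (fun z : E => c • z) (μ.restrict B) (μ.restrict B) := by
  have hc0 : c ≠ 0 := norm_ne_zero_iff.1 (hc ▸ one_ne_zero)
  have hpre : (fun z : E => c • z) ⁻¹' B = B := Set.ext fun z => by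
    simpa using hB.smul_mem_iff (x := z) (hc.trans norm_one.symm)
  have := (measurePreserving_smul_of_norm_eq_one (μ := μ) hc).restrict_preimage_emb
    (measurableEmbedding_const_smul₀ hc0) B
  rwa [hpre] at this

theorem integrable_circleMap_smul_of_balanced (hBo : IsOpen B) (hB : Balanced ℂ B)
    (hf : DifferentiableOn ℂ f B) (hfi : IntegrableOn f B μ) :
    Integrable (Function.uncurry fun (θ : ℝ) (z : E) => f (circleMap 0 1 θ • z))
      ((volume.restrict (Ioc 0 (2 * Real.pi))).prod (μ.restrict B)) := by
  have := FiniteDimensional.proper ℂ E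
  have hrot : ∀ θ, MeasurePreserving (fun z : E => circleMap 0 1 θ • z) (μ.restrict B)
      (μ.restrict B) := fun θ => measurePreserving_smul_restrict_of_balanced hB (by simp)
  have hemb : ∀ θ, MeasurableEmbedding fun z : E => circleMap 0 1 θ • z :=
    fun θ => measurableEmbedding_const_smul₀ (circleMap_ne_center one_ne_zero)
  rw [integrable_prod_iff]
  · refine ⟨Eventually.of_forall fun θ => (hrot θ).integrable_comp_of_integrable hfi, ?_⟩
    simp only [Function.uncurry_apply_pair, (hrot _).integral_comp (hemb _) fun z => ‖f z‖]
    exact integrable_const _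
  · rw [Measure.prod_restrict]
    refine ContinuousOn.aestronglyMeasurable ?_ (measurableSet_Ioc.prod hBo.measurableSet)
    refine hf.continuousOn.comp (f := fun q : ℝ × E => circleMap 0 1 q.1 • q.2)
      (by fun_prop) fun q hq => hB.smul_mem (by simp) hq.2

theorem setIntegral_eq_of_balanced [CompleteSpace F] (hBo : IsOpen B) (hB : Balanced ℂ B)
    (hf : DifferentiableOn ℂ f B) (hfi : IntegrableOn f B μ) :
    ∫ z in B, f z ∂μ = μ.real B • f 0 := by
  have := FiniteDimensional.proper ℂ E
  have hrot : ∀ θ, ∫ z in B, f (circleMap 0 1 θ • z) ∂μ = ∫ z in B, f z ∂μ := fun θ =>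
    (measurePreserving_smul_restrict_of_balanced hB (by simp)).integral_comp
      (measurableEmbedding_const_smul₀ (circleMap_ne_center one_ne_zero)) f
  have hmean : ∀ z ∈ B, ∫ θ in Ioc 0 (2 * Real.pi), f (circleMap 0 1 θ • z) =
      (2 * Real.pi) • f 0 := fun z hz => by
    rw [← circleAverage_smul_of_balanced hB hf hz, Real.circleAverage_def,
      smul_inv_smul₀ Real.two_pi_pos.ne', intervalIntegral.integral_of_le Real.two_pi_pos.le]
  have hswap := integral_integral_swap (integrable_circleMap_smul_of_balanced hBo hB hf hfi)
  simp only [hrot] at hswap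
  rw [setIntegral_congr_fun hBo.measurableSet hmean, setIntegral_const, setIntegral_const,
    Real.volume_real_Ioc_of_le Real.two_pi_pos.le, sub_zero, smul_comm] at hswap
  exact smul_right_injective F Real.two_pi_pos.ne' hswap

end Balanced

/-! ### Biholomorphisms and their Jacobians -/

section Biholomorphism

variable {n : ℕ} {F G F' G' : (Fin n → ℂ) → (Fin n → ℂ)} {A B C Ω : Set (Fin n → ℂ)}
  {z : Fin n → ℂ}

/-- The complex Jacobian matrix `[∂F_i/∂z_j]` of `F` at `z`. -/
noncomputable def jacobianMatrix (F : (Fin n → ℂ) → (Fin n → ℂ)) (z : Fin n → ℂ) :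
    Matrix (Fin n) (Fin n) ℂ :=
  LinearMap.toMatrix' (fderiv ℂ F z)

theorem jacobianMatrix_apply (F : (Fin n → ℂ) → (Fin n → ℂ)) (z : Fin n → ℂ) (i j : Fin n) :
    jacobianMatrix F z i j = fderiv ℂ F z (Pi.single j 1) i := rfl

theorem jacobianMatrix_mulVec (F : (Fin n → ℂ) → (Fin n → ℂ)) (z v : Fin n → ℂ) :
    jacobianMatrix F z *ᵥ v = fderiv ℂ F z v :=
  LinearMap.toMatrix'_mulVec _ v

/-- The complex Jacobian determinant of `F` at `z`. -/
noncomputable def complexJacobian (F : (Fin n → ℂ) → (Fin n → ℂ)) (z : Fin n → ℂ) : ℂ :=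
  (fderiv ℂ F z).det

theorem det_jacobianMatrix (F : (Fin n → ℂ) → (Fin n → ℂ)) (z : Fin n → ℂ) :
    (jacobianMatrix F z).det = complexJacobian F z :=
  LinearMap.det_toMatrix' _

theorem differentiableOn_complexJacobian (hΩ : IsOpen Ω) (hF : DifferentiableOn ℂ F Ω) :
    DifferentiableOn ℂ (complexJacobian F) Ω := by
  have hentry (i j : Fin n) : DifferentiableOn ℂ (fun z => fderiv ℂ F z (Pi.single j 1) i) Ω :=
    differentiableOn_pi.1 (differentiableOn_fderiv_apply hΩ hF _) i
  simp only [← funext (det_jacobianMatrix F), Matrix.det_apply, jacobianMatrix_apply]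
  refine DifferentiableOn.fun_sum fun σ _ => DifferentiableOn.const_smul (fun z hz => ?_) _
  exact (HasFDerivWithinAt.finsetProd fun i _ =>
    (hentry (σ i) i z hz).hasFDerivWithinAt).differentiableWithinAt

namespace IsBiholomorphism

theorem symm (h : IsBiholomorphism F G A B) : IsBiholomorphism G F B A :=
  ⟨h.mapsTo_inv, h.mapsTo, h.invOn.symm, h.holomorphic_inv, h.holomorphic⟩

theorem trans (h : IsBiholomorphism F G A B) (h' : IsBiholomorphism F' G' B C) :
    IsBiholomorphism (F' ∘ F) (G ∘ G') A C where
  mapsTo := h'.mapsTo.comp h.mapsTo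
  mapsTo_inv := h.mapsTo_inv.comp h'.mapsTo_inv
  invOn := h.invOn.comp h'.invOn h.mapsTo h'.mapsTo_inv
  holomorphic := h'.holomorphic.comp h.holomorphic h.mapsTo
  holomorphic_inv := h.holomorphic_inv.comp h'.holomorphic_inv h'.mapsTo_inv

theorem congr (h : IsBiholomorphism F G A B) (hF : EqOn F' F A) (hG : EqOn G' G B) :
    IsBiholomorphism F' G' A B where
  mapsTo := h.mapsTo.congr hF.symm
  mapsTo_inv := h.mapsTo_inv.congr hG.symm
  invOn := ⟨(h.invOn.1.congr_left h.mapsTo hG.symm).congr_right hF.symm,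
    (h.invOn.2.congr_right h.mapsTo_inv hF.symm).congr_left hG.symm⟩
  holomorphic := h.holomorphic.congr hF
  holomorphic_inv := h.holomorphic_inv.congr hG

theorem image_eq (h : IsBiholomorphism F G A B) : F '' A = B :=
  h.mapsTo.image_subset.antisymm fun w hw => ⟨G w, h.mapsTo_inv hw, h.invOn.2 hw⟩

theorem differentiableAt (h : IsBiholomorphism F G A B) (hA : IsOpen A) (hz : z ∈ A) :
    DifferentiableAt ℂ F z :=
  h.holomorphic.differentiableAt (hA.mem_nhds hz)

theorem fderiv_comp_fderiv (h : IsBiholomorphism F G A B) (hA : IsOpen A) (hB : IsOpen B)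
    (hz : z ∈ A) : (fderiv ℂ G (F z)).comp (fderiv ℂ F z) = ContinuousLinearMap.id ℂ _ := by
  have heq : G ∘ F =ᶠ[𝓝 z] id := by
    filter_upwards [hA.mem_nhds hz] with w hw using h.invOn.1 hw
  rw [← fderiv_comp z (h.symm.differentiableAt hB (h.mapsTo hz)) (h.differentiableAt hA hz),
    heq.fderiv_eq, fderiv_id]

theorem jacobianMatrix_mul_jacobianMatrix (h : IsBiholomorphism F G A B) (hA : IsOpen A)
    (hB : IsOpen B) (hz : z ∈ A) : jacobianMatrix G (F z) * jacobianMatrix F z = 1 := by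
  rw [jacobianMatrix, jacobianMatrix, ← LinearMap.toMatrix'_comp,
    ← ContinuousLinearMap.toLinearMap_comp, h.fderiv_comp_fderiv hA hB hz]
  exact LinearMap.toMatrix'_id

theorem fderiv_inv_fderiv (h : IsBiholomorphism F G A B) (hA : IsOpen A) (hB : IsOpen B)
    (hz : z ∈ A) (v : Fin n → ℂ) : fderiv ℂ G (F z) (fderiv ℂ F z v) = v :=
  DFunLike.congr_fun (h.fderiv_comp_fderiv hA hB hz) v

theorem fderiv_fderiv_inv (h : IsBiholomorphism F G A B) (hA : IsOpen A) (hB : IsOpen B)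
    (hz : z ∈ A) (v : Fin n → ℂ) : fderiv ℂ F z (fderiv ℂ G (F z) v) = v := by
  rw [← jacobianMatrix_mulVec, ← jacobianMatrix_mulVec, Matrix.mulVec_mulVec,
    mul_eq_one_comm.1 (h.jacobianMatrix_mul_jacobianMatrix hA hB hz), Matrix.one_mulVec]

theorem complexJacobian_mul_complexJacobian (h : IsBiholomorphism F G A B) (hA : IsOpen A)
    (hB : IsOpen B) (hz : z ∈ A) : complexJacobian G (F z) * complexJacobian F z = 1 := by
  rw [← det_jacobianMatrix, ← det_jacobianMatrix, ← Matrix.det_mul,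
    h.jacobianMatrix_mul_jacobianMatrix hA hB hz, Matrix.det_one]

theorem complexJacobian_ne_zero (h : IsBiholomorphism F G A B) (hA : IsOpen A) (hB : IsOpen B)
    (hz : z ∈ A) : complexJacobian F z ≠ 0 :=
  right_ne_zero_of_mul_eq_one (h.complexJacobian_mul_complexJacobian hA hB hz)

section ChangeOfVariables

variable {E : Type*} [NormedAddCommGroup E] [NormedSpace ℝ E]

theorem hasFDerivWithinAt_restrictScalars (h : IsBiholomorphism F G A B) (hA : IsOpen A) :
    ∀ z ∈ A, HasFDerivWithinAt F ((fderiv ℂ F z).restrictScalars ℝ) A z := fun _ hz =>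
  ((h.differentiableAt hA hz).hasFDerivAt.restrictScalars ℝ).hasFDerivWithinAt

theorem integral_eq (h : IsBiholomorphism F G A B) (hA : IsOpen A) (f : (Fin n → ℂ) → E) :
    ∫ w in B, f w = ∫ z in A, ‖complexJacobian F z‖ ^ 2 • f (F z) := by
  rw [← h.image_eq, integral_image_eq_integral_abs_det_fderiv_smul volume hA.measurableSet
    (h.hasFDerivWithinAt_restrictScalars hA) h.invOn.1.injOn]
  simp only [abs_det_restrictScalars, complexJacobian]

theorem integrableOn_iff (h : IsBiholomorphism F G A B) (hA : IsOpen A) (f : (Fin n → ℂ) → E) :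
    IntegrableOn f B ↔ IntegrableOn (fun z => ‖complexJacobian F z‖ ^ 2 • f (F z)) A := by
  rw [← h.image_eq, integrableOn_image_iff_integrableOn_abs_det_fderiv_smul volume
    hA.measurableSet (h.hasFDerivWithinAt_restrictScalars hA) h.invOn.1.injOn]
  simp only [abs_det_restrictScalars, complexJacobian]

end ChangeOfVariables

end IsBiholomorphism

end Biholomorphism

/-! ### The unit ball and its involutive automorphisms -/

section UnitBall

variable {n : ℕ} {a z w : Fin n → ℂ}

theorem euclideanBall_eq_preimage (a : Fin n → ℂ) (r : ℝ) :
    euclideanBall a r = WithLp.toLp 2 ⁻¹' ball (WithLp.toLp 2 a) |r| := by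
  ext z
  rw [mem_preimage, mem_ball, dist_eq_norm, ← sq_lt_sq₀ (norm_nonneg _) (abs_nonneg r), sq_abs,
    EuclideanSpace.norm_sq_eq]
  rfl

theorem isOpen_euclideanBall (a : Fin n → ℂ) (r : ℝ) : IsOpen (euclideanBall a r) :=
  isOpen_lt (by fun_prop) continuous_const

theorem convex_euclideanBall (a : Fin n → ℂ) (r : ℝ) : Convex ℝ (euclideanBall a r) := by
  rw [euclideanBall_eq_preimage]
  exact (convex_ball _ _).linear_preimage (WithLp.linearEquiv 2 ℝ (Fin n → ℂ)).symm.toLinearMap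

theorem isBounded_euclideanBall (a : Fin n → ℂ) (r : ℝ) :
    Bornology.IsBounded (euclideanBall a r) := by
  rw [euclideanBall_eq_preimage]
  exact (PiLp.antilipschitzWith_toLp 2 _).isBounded_preimage isBounded_ball

theorem mem_unitBall : z ∈ euclideanBall 0 1 ↔ ‖WithLp.toLp 2 z‖ < 1 := by
  simp only [euclideanBall_eq_preimage, mem_preimage, WithLp.toLp_zero, abs_one,
    mem_ball_zero_iff]

theorem zero_mem_unitBall : (0 : Fin n → ℂ) ∈ euclideanBall 0 1 := by
  simp only [mem_unitBall, WithLp.toLp_zero, norm_zero, zero_lt_one]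

theorem volume_real_unitBall_pos : 0 < volume.real (euclideanBall (0 : Fin n → ℂ) 1) :=
  ENNReal.toReal_pos ((isOpen_euclideanBall 0 1).measure_pos volume ⟨0, zero_mem_unitBall⟩).ne'
    (isBounded_euclideanBall 0 1).measure_lt_top.ne

theorem balanced_unitBall : Balanced ℂ (euclideanBall (0 : Fin n → ℂ) 1) := by
  refine balanced_iff_smul_mem.2 fun c hc z hz => mem_unitBall.2 ?_
  rw [WithLp.toLp_smul, norm_smul]
  exact (mul_le_of_le_one_left (norm_nonneg _) hc).trans_lt (mem_unitBall.1 hz)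

theorem dotProduct_star_self (z : Fin n → ℂ) :
    z ⬝ᵥ star z = ((‖WithLp.toLp 2 z‖ ^ 2 : ℝ) : ℂ) := by
  rw [← EuclideanSpace.inner_toLp_toLp, inner_self_eq_norm_sq_to_K, Complex.ofReal_pow]
  rfl

theorem star_dotProduct_star (z w : Fin n → ℂ) : star (z ⬝ᵥ star w) = w ⬝ᵥ star z := by
  rw [← Matrix.star_dotProduct_star, star_star]

theorem norm_dotProduct_star_le (z w : Fin n → ℂ) :
    ‖z ⬝ᵥ star w‖ ≤ ‖WithLp.toLp 2 w‖ * ‖WithLp.toLp 2 z‖ := by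
  rw [← EuclideanSpace.inner_toLp_toLp]
  exact norm_inner_le_norm _ _

theorem one_sub_dotProduct_star_ne_zero (hz : z ∈ euclideanBall 0 1)
    (hw : w ∈ euclideanBall 0 1) : 1 - z ⬝ᵥ star w ≠ 0 := by
  rw [mem_unitBall] at hz hw
  refine sub_ne_zero.2 fun h => absurd ?_ (mul_lt_one_of_nonneg_of_lt_one_left
    (norm_nonneg _) hw hz.le).not_ge
  simpa only [← h, norm_one] using norm_dotProduct_star_le z w

/-- The linear functional `z ↦ ⟨z, a⟩ = ∑ i, z i * conj (a i)`. -/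
noncomputable def dotProductStar (a : Fin n → ℂ) : (Fin n → ℂ) →L[ℂ] ℂ :=
  LinearMap.toContinuousLinearMap ((dotProductBilin ℂ ℂ).flip (star a))

theorem dotProductStar_apply (a z : Fin n → ℂ) : dotProductStar a z = z ⬝ᵥ star a := rfl

/-- The real number `√(1 - |a|²)`, by which the automorphism of the unit ball that exchanges `0`
and `a` scales the orthogonal complement of `a` at `0`. -/
noncomputable def ballConorm (a : Fin n → ℂ) : ℝ := √(1 - ‖WithLp.toLp 2 a‖ ^ 2)

theorem ballConorm_pos (ha : a ∈ euclideanBall 0 1) : 0 < ballConorm a :=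
  Real.sqrt_pos.2 (sub_pos.2 ((sq_lt_one_iff₀ (norm_nonneg _)).2 (mem_unitBall.1 ha)))

theorem dotProduct_star_self_eq_one_sub_ballConorm_sq (ha : a ∈ euclideanBall 0 1) :
    a ⬝ᵥ star a = 1 - (ballConorm a : ℂ) ^ 2 := by
  have h := (sq_lt_one_iff₀ (norm_nonneg _)).2 (mem_unitBall.1 ha)
  rw [dotProduct_star_self, ballConorm, ← Complex.ofReal_pow, Real.sq_sqrt (sub_nonneg.2 h.le),
    Complex.ofReal_sub, Complex.ofReal_one, sub_sub_cancel]

theorem one_add_ballConorm_ne_zero (a : Fin n → ℂ) : (1 + ballConorm a : ℂ) ≠ 0 := by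
  have : 0 ≤ ballConorm a := Real.sqrt_nonneg _
  exact_mod_cast (by positivity : 1 + ballConorm a ≠ 0)

/-- The involutive automorphism of the unit ball that exchanges `0` and `a`. -/
noncomputable def ballInvolution (a z : Fin n → ℂ) : Fin n → ℂ :=
  (1 - z ⬝ᵥ star a)⁻¹ •
    (a - (ballConorm a : ℂ) • z - (z ⬝ᵥ star a / (1 + ballConorm a)) • a)

theorem ballInvolution_zero (a : Fin n → ℂ) : ballInvolution a 0 = a := by
  simp only [ballInvolution, zero_dotProduct, sub_zero, inv_one, smul_zero, zero_div, zero_smul,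
    one_smul]

theorem one_sub_ballInvolution_dotProduct_star (ha : a ∈ euclideanBall 0 1)
    (hz : z ∈ euclideanBall 0 1) (hw : w ∈ euclideanBall 0 1) :
    1 - ballInvolution a z ⬝ᵥ star (ballInvolution a w) =
      (ballConorm a : ℂ) ^ 2 * (1 - z ⬝ᵥ star w) /
        ((1 - z ⬝ᵥ star a) * (1 - a ⬝ᵥ star w)) := by
  have hs := one_add_ballConorm_ne_zero a
  have hza := one_sub_dotProduct_star_ne_zero hz ha
  have haw := one_sub_dotProduct_star_ne_zero ha hw
  have hstar : star (ballConorm a : ℂ) = ballConorm a := Complex.conj_ofReal _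
  simp only [ballInvolution, smul_dotProduct, sub_dotProduct, dotProduct_smul, dotProduct_sub,
    star_smul, star_sub, star_inv₀, star_div₀, star_one, star_add, smul_eq_mul,
    star_dotProduct_star, hstar, dotProduct_star_self_eq_one_sub_ballConorm_sq ha]
  field_simp
  ring

theorem one_sub_ballInvolution_dotProduct_star_center (ha : a ∈ euclideanBall 0 1)
    (hz : z ∈ euclideanBall 0 1) :
    1 - ballInvolution a z ⬝ᵥ star a = (ballConorm a : ℂ) ^ 2 / (1 - z ⬝ᵥ star a) := by
  simpa only [ballInvolution_zero, star_zero, dotProduct_zero, sub_zero, mul_one] using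
    one_sub_ballInvolution_dotProduct_star ha hz zero_mem_unitBall

theorem mapsTo_ballInvolution (ha : a ∈ euclideanBall 0 1) :
    MapsTo (ballInvolution a) (euclideanBall 0 1) (euclideanBall 0 1) := by
  intro z hz
  have hz' := (sq_lt_one_iff₀ (norm_nonneg _)).2 (mem_unitBall.1 hz)
  have hza := norm_pos_iff.2 (one_sub_dotProduct_star_ne_zero hz ha)
  have hnorm : 1 - ‖WithLp.toLp 2 (ballInvolution a z)‖ ^ 2 =
      ballConorm a ^ 2 * (1 - ‖WithLp.toLp 2 z‖ ^ 2) / ‖1 - z ⬝ᵥ star a‖ ^ 2 := by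
    have h := one_sub_ballInvolution_dotProduct_star ha hz hz
    rw [← star_dotProduct_star z a, ← star_one ℂ, ← star_sub, star_one, Complex.star_def,
      Complex.mul_conj', dotProduct_star_self, dotProduct_star_self] at h
    exact_mod_cast h
  have hpos : 0 < 1 - ‖WithLp.toLp 2 (ballInvolution a z)‖ ^ 2 := by
    rw [hnorm]
    exact div_pos (mul_pos (pow_pos (ballConorm_pos ha) 2) (sub_pos.2 hz')) (pow_pos hza 2)
  exact mem_unitBall.2 ((sq_lt_one_iff₀ (norm_nonneg _)).1 (sub_pos.1 hpos))

theorem ballInvolution_ballInvolution (ha : a ∈ euclideanBall 0 1) (hz : z ∈ euclideanBall 0 1) :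
    ballInvolution a (ballInvolution a z) = z := by
  have hs := one_add_ballConorm_ne_zero a
  have hs0 : (ballConorm a : ℂ) ≠ 0 := by exact_mod_cast (ballConorm_pos ha).ne'
  have hza := one_sub_dotProduct_star_ne_zero hz ha
  have hdot : ballInvolution a z ⬝ᵥ star a =
      1 - (ballConorm a : ℂ) ^ 2 / (1 - z ⬝ᵥ star a) := by
    rw [← one_sub_ballInvolution_dotProduct_star_center ha hz, sub_sub_cancel]
  rw [ballInvolution, hdot, ballInvolution]
  ext i
  simp only [Pi.smul_apply, Pi.sub_apply, smul_eq_mul]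
  field_simp
  ring

theorem ballInvolution_self (ha : a ∈ euclideanBall 0 1) : ballInvolution a a = 0 := by
  simpa only [ballInvolution_zero] using ballInvolution_ballInvolution ha zero_mem_unitBall

theorem hasFDerivAt_ballInvolution (ha : a ∈ euclideanBall 0 1) (hz : z ∈ euclideanBall 0 1) :
    HasFDerivAt (ballInvolution a)
      ((-(ballConorm a / (1 - z ⬝ᵥ star a)) : ℂ) • LinearMap.toContinuousLinearMap
        (LinearMap.transvection (dotProductStar a : (Fin n → ℂ) →ₗ[ℂ] ℂ)
          ((ballConorm a : ℂ)⁻¹ • ((1 + ballConorm a : ℂ)⁻¹ • a - ballInvolution a z)))) z := by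
  have hs := one_add_ballConorm_ne_zero a
  have hs0 : (ballConorm a : ℂ) ≠ 0 := by exact_mod_cast (ballConorm_pos ha).ne'
  have hza := one_sub_dotProduct_star_ne_zero hz ha
  have hφ : HasFDerivAt (fun x => x ⬝ᵥ star a) (dotProductStar a) z :=
    (dotProductStar a).hasFDerivAt
  have hinv := (hasDerivAt_inv hza).comp_hasFDerivAt z (hφ.const_sub 1)
  have hnum := (((hasFDerivAt_id z).const_smul (ballConorm a : ℂ)).const_sub a).sub
    ((hφ.mul_const (1 + ballConorm a : ℂ)⁻¹).smul_const a)
  refine (hinv.smul hnum).congr_fderiv (ContinuousLinearMap.ext fun x => ?_)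
  ext i
  simp only [Function.comp_apply, Complex.coe_smul, smul_neg, neg_smul, neg_neg, Pi.smul_apply,
    id_eq, Pi.sub_apply, add_apply, smul_apply, sub_apply, neg_apply,
    ContinuousLinearMap.id_apply, ContinuousLinearMap.smulRight_apply, dotProductStar_apply,
    smul_eq_mul, Pi.add_apply, Pi.neg_apply, Complex.real_smul, ballInvolution,
    LinearMap.coe_toContinuousLinearMap', LinearMap.transvection.apply,
    ContinuousLinearMap.coe_coe, neg_mul]
  field_simp
  ring

theorem complexJacobian_ballInvolution (ha : a ∈ euclideanBall 0 1)
    (hz : z ∈ euclideanBall 0 1) :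
    complexJacobian (ballInvolution a) z =
      (-1) ^ n * (ballConorm a / (1 - z ⬝ᵥ star a)) ^ (n + 1) := by
  have hs := one_add_ballConorm_ne_zero a
  have hs0 : (ballConorm a : ℂ) ≠ 0 := by exact_mod_cast (ballConorm_pos ha).ne'
  have hza := one_sub_dotProduct_star_ne_zero hz ha
  have hdot : ballInvolution a z ⬝ᵥ star a =
      1 - (ballConorm a : ℂ) ^ 2 / (1 - z ⬝ᵥ star a) := by
    rw [← one_sub_ballInvolution_dotProduct_star_center ha hz, sub_sub_cancel]
  have htrans : 1 + dotProductStar a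
      ((ballConorm a : ℂ)⁻¹ • ((1 + ballConorm a : ℂ)⁻¹ • a - ballInvolution a z)) =
        ballConorm a / (1 - z ⬝ᵥ star a) := by
    simp only [dotProductStar_apply, smul_dotProduct, sub_dotProduct, smul_eq_mul, hdot,
      dotProduct_star_self_eq_one_sub_ballConorm_sq ha]
    field_simp
    ring
  rw [complexJacobian, (hasFDerivAt_ballInvolution ha hz).fderiv, ContinuousLinearMap.det,
    ContinuousLinearMap.toLinearMap_smul, LinearMap.coe_toContinuousLinearMap, LinearMap.det_smul,
    LinearMap.transvection.det, ContinuousLinearMap.coe_coe, htrans, Module.finrank_fin_fun,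
    neg_pow, mul_assoc, ← pow_succ]

theorem isBiholomorphism_ballInvolution (ha : a ∈ euclideanBall 0 1) :
    IsBiholomorphism (ballInvolution a) (ballInvolution a) (euclideanBall 0 1)
      (euclideanBall 0 1) where
  mapsTo := mapsTo_ballInvolution ha
  mapsTo_inv := mapsTo_ballInvolution ha
  invOn := ⟨fun _ => ballInvolution_ballInvolution ha, fun _ => ballInvolution_ballInvolution ha⟩
  holomorphic _ hz := (hasFDerivAt_ballInvolution ha hz).differentiableAt.differentiableWithinAt
  holomorphic_inv _ hz :=
    (hasFDerivAt_ballInvolution ha hz).differentiableAt.differentiableWithinAt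

end UnitBall

/-! ### The Bergman kernel -/

section BergmanKernel

variable {n : ℕ} {A B Ω : Set (Fin n → ℂ)} {F G : (Fin n → ℂ) → (Fin n → ℂ)}
  {f g k k' : (Fin n → ℂ) → ℂ} {p t z : Fin n → ℂ}

theorem MemBergmanSpace.integrable_mul_conj (hf : MemBergmanSpace Ω f)
    (hg : MemBergmanSpace Ω g) :
    IntegrableOn (fun z => f z * starRingEnd ℂ (g z)) Ω :=
  hf.2.integrable_mul hg.2.star

theorem MemBergmanSpace.eqOn_zero_of_integral_eq_zero (hΩ : IsOpen Ω) (hf : MemBergmanSpace Ω f)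
    (h : ∫ z in Ω, f z * starRingEnd ℂ (f z) = 0) : EqOn f 0 Ω := by
  have hint := hf.2.norm.integrable_sq
  simp only [Complex.mul_conj', ← Complex.ofReal_pow] at h
  rw [integral_complex_ofReal, Complex.ofReal_eq_zero,
    integral_eq_zero_iff_of_nonneg (fun z => sq_nonneg ‖f z‖) hint] at h
  have hae : f =ᵐ[volume.restrict Ω] 0 := by
    filter_upwards [h] with z hz using norm_eq_zero.1 (sq_eq_zero_iff.1 hz)
  exact Measure.eqOn_open_of_ae_eq hae hΩ hf.1.continuousOn continuousOn_const

theorem IsReproducingAt.eqOn (hΩ : IsOpen Ω) (hk : IsReproducingAt Ω p k)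
    (hk' : IsReproducingAt Ω p k') : EqOn k k' Ω := by
  have hd : MemBergmanSpace Ω (k - k') := ⟨hk.1.1.sub hk'.1.1, hk.1.2.sub hk'.1.2⟩
  have hzero : ∫ z in Ω, (k - k') z * starRingEnd ℂ ((k - k') z) = 0 := by
    have hsub := integral_sub (hd.integrable_mul_conj hk.1) (hd.integrable_mul_conj hk'.1)
    rw [← hk.2 _ hd, ← hk'.2 _ hd, sub_self] at hsub
    simpa only [Pi.sub_apply, map_sub, mul_sub] using hsub
  exact fun z hz => sub_eq_zero.1 (hd.eqOn_zero_of_integral_eq_zero hΩ hzero hz)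

theorem IsReproducingAt.isReproducingAt_bergmanKernel (hk : IsReproducingAt Ω p k) :
    IsReproducingAt Ω p fun z => bergmanKernel Ω z p := by
  have hex : ∃ k, IsReproducingAt Ω p k := ⟨k, hk⟩
  simpa only [bergmanKernel, dif_pos hex] using hex.choose_spec

theorem IsReproducingAt.bergmanKernel_eq (hΩ : IsOpen Ω) (hk : IsReproducingAt Ω p k)
    (hz : z ∈ Ω) : bergmanKernel Ω z p = k z :=
  hk.isReproducingAt_bergmanKernel.eqOn hΩ hk hz

namespace IsBiholomorphism

theorem memBergmanSpace_pullback (h : IsBiholomorphism F G A B) (hA : IsOpen A)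
    (hg : MemBergmanSpace B g) : MemBergmanSpace A fun z => complexJacobian F z * g (F z) := by
  have hd : DifferentiableOn ℂ (fun z => complexJacobian F z * g (F z)) A :=
    (differentiableOn_complexJacobian hA h.holomorphic).mul (hg.1.comp h.holomorphic h.mapsTo)
  refine ⟨hd, (memLp_two_iff_integrable_sq_norm
    (hd.continuousOn.aestronglyMeasurable hA.measurableSet)).2 ?_⟩
  simpa only [norm_mul, mul_pow, IntegrableOn, smul_eq_mul] using
    (h.integrableOn_iff hA _).1 hg.2.norm.integrable_sq

theorem integral_pullback_mul_conj_pullback (h : IsBiholomorphism F G A B) (hA : IsOpen A)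
    (f g : (Fin n → ℂ) → ℂ) :
    ∫ z in A, complexJacobian F z * f (F z) * starRingEnd ℂ (complexJacobian F z * g (F z)) =
      ∫ w in B, f w * starRingEnd ℂ (g w) := by
  rw [h.integral_eq hA]
  refine integral_congr_ae (Eventually.of_forall fun z => ?_)
  simp only [map_mul, Complex.real_smul, Complex.ofReal_pow, ← Complex.mul_conj']
  ring

theorem isReproducingAt_pullback (h : IsBiholomorphism F G A B) (hA : IsOpen A) (hB : IsOpen B)
    (ht : t ∈ A) (hk : IsReproducingAt B (F t) k) :
    IsReproducingAt A t fun z =>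
      complexJacobian F z * k (F z) * starRingEnd ℂ (complexJacobian F t) := by
  have hkA := h.memBergmanSpace_pullback hA hk.1
  refine ⟨⟨hkA.1.mul_const _, hkA.2.mul_const _⟩, fun f hf => ?_⟩
  have hg := h.symm.memBergmanSpace_pullback hB hf
  have hpull : ∀ z ∈ A, complexJacobian F z * (complexJacobian G (F z) * f (G (F z))) = f z :=
    fun z hz => by
      rw [h.invOn.1 hz, ← mul_assoc, mul_comm (complexJacobian F z),
        h.complexJacobian_mul_complexJacobian hA hB hz, one_mul]
  calc f t = complexJacobian F t *
        ∫ w in B, complexJacobian G w * f (G w) * starRingEnd ℂ (k w) := by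
        rw [← hk.2 _ hg, hpull t ht]
    _ = complexJacobian F t *
        ∫ z in A, f z * starRingEnd ℂ (complexJacobian F z * k (F z)) := by
        rw [← h.integral_pullback_mul_conj_pullback hA]
        congr 1
        exact setIntegral_congr_fun hA.measurableSet fun z hz => by rw [hpull z hz]
    _ = ∫ z in A, f z * starRingEnd ℂ
          (complexJacobian F z * k (F z) * starRingEnd ℂ (complexJacobian F t)) := by
        rw [← integral_const_mul]
        simp only [map_mul, Complex.conj_conj, mul_comm, mul_left_comm]

theorem bergmanKernel_eq (h : IsBiholomorphism F G A B) (hA : IsOpen A) (hB : IsOpen B)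
    (hz : z ∈ A) (ht : t ∈ A) (hk : IsReproducingAt B (F t) k) :
    bergmanKernel A z t = complexJacobian F z * bergmanKernel B (F z) (F t) *
      starRingEnd ℂ (complexJacobian F t) :=
  (h.isReproducingAt_pullback hA hB ht hk.isReproducingAt_bergmanKernel).bergmanKernel_eq hA hz

end IsBiholomorphism

theorem isReproducingAt_zero_of_balanced (hBo : IsOpen B) (hB : Balanced ℂ B) (hne : B.Nonempty)
    (hvol : volume B ≠ ⊤) :
    IsReproducingAt B 0 fun _ => (volume.real B : ℂ)⁻¹ := by
  have hV : (volume.real B : ℂ) ≠ 0 := by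
    exact_mod_cast (ENNReal.toReal_pos (hBo.measure_pos volume hne).ne' hvol).ne'
  have : IsFiniteMeasure (volume.restrict B) := ⟨by simpa using hvol.lt_top⟩
  refine ⟨⟨differentiableOn_const _, memLp_const _⟩, fun f hf => ?_⟩
  have hmean := setIntegral_eq_of_balanced hBo hB hf.1 (hf.2.integrable one_le_two)
  rw [integral_mul_const, hmean, map_inv₀, Complex.conj_ofReal, Complex.real_smul,
    mul_right_comm, mul_inv_cancel₀ hV, one_mul]

theorem isReproducingAt_unitBall_zero :
    IsReproducingAt (euclideanBall (0 : Fin n → ℂ) 1) 0 fun _ =>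
      (volume.real (euclideanBall (0 : Fin n → ℂ) 1) : ℂ)⁻¹ :=
  isReproducingAt_zero_of_balanced (isOpen_euclideanBall 0 1) balanced_unitBall
    ⟨0, zero_mem_unitBall⟩ (isBounded_euclideanBall 0 1).measure_lt_top.ne

theorem isReproducingAt_unitBall (ht : t ∈ euclideanBall 0 1) :
    IsReproducingAt (euclideanBall 0 1) t fun z =>
      complexJacobian (ballInvolution t) z *
        (volume.real (euclideanBall (0 : Fin n → ℂ) 1) : ℂ)⁻¹ *
          starRingEnd ℂ (complexJacobian (ballInvolution t) t) := by
  have hzero : IsReproducingAt (euclideanBall 0 1) (ballInvolution t t) fun _ =>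
      (volume.real (euclideanBall (0 : Fin n → ℂ) 1) : ℂ)⁻¹ := by
    rw [ballInvolution_self ht]
    exact isReproducingAt_unitBall_zero
  have hB := isOpen_euclideanBall (0 : Fin n → ℂ) 1
  have hpullback := (isBiholomorphism_ballInvolution ht).isReproducingAt_pullback hB hB ht hzero
  exact hpullback

theorem bergmanKernel_unitBall (hz : z ∈ euclideanBall 0 1) (ht : t ∈ euclideanBall 0 1) :
    bergmanKernel (euclideanBall 0 1) z t =
      (volume.real (euclideanBall (0 : Fin n → ℂ) 1) : ℂ)⁻¹ *
        ((1 - z ⬝ᵥ star t) ^ (n + 1))⁻¹ := by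
  have hs : (ballConorm t : ℂ) ≠ 0 := by exact_mod_cast (ballConorm_pos ht).ne'
  have hzt := one_sub_dotProduct_star_ne_zero hz ht
  have hsign : ((-1 : ℂ) ^ n) * (-1) ^ n = 1 := by rw [← mul_pow, neg_one_mul, neg_neg, one_pow]
  rw [(isReproducingAt_unitBall ht).bergmanKernel_eq (isOpen_euclideanBall 0 1) hz,
    complexJacobian_ballInvolution ht hz, complexJacobian_ballInvolution ht ht,
    dotProduct_star_self_eq_one_sub_ballConorm_sq ht, sub_sub_cancel]
  simp only [map_mul, map_pow, map_neg, map_one, map_div₀, Complex.conj_ofReal, div_pow]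
  field_simp
  linear_combination (ballConorm t ^ (n + 1)) ^ 2 /
    (volume.real (euclideanBall (0 : Fin n → ℂ) 1) : ℂ) * hsign

theorem IsBiholomorphism.bergmanKernel_eq_of_unitBall
    (h : IsBiholomorphism F G Ω (euclideanBall 0 1)) (hΩ : IsOpen Ω) (hz : z ∈ Ω) (ht : t ∈ Ω) :
    bergmanKernel Ω z t = (volume.real (euclideanBall (0 : Fin n → ℂ) 1) : ℂ)⁻¹ *
      complexJacobian F z * starRingEnd ℂ (complexJacobian F t) *
        ((1 - F z ⬝ᵥ star (F t)) ^ (n + 1))⁻¹ := by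
  rw [h.bergmanKernel_eq hΩ (isOpen_euclideanBall 0 1) hz ht
    (isReproducingAt_unitBall (h.mapsTo ht)), bergmanKernel_unitBall (h.mapsTo hz) (h.mapsTo ht)]
  ring

end BergmanKernel

/-! ### Wirtinger calculus -/

section Wirtinger

variable {n : ℕ} {c : ℂ} {j : Fin n} {f g : (Fin n → ℂ) → ℂ} {f' g' : ℂ} {z : Fin n → ℂ}

/-- `f` is real differentiable at `z` and `(∂f/∂x_j + c ∂f/∂y_j) / 2` takes the value `f'` there.
The choices `c = -i` and `c = i` give the two Wirtinger derivatives `∂/∂z_j` and `∂/∂z̄_j`; with `c`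
arbitrary the rules of calculus are stated once for both. -/
structure HasWirtingerAt (c : ℂ) (j : Fin n) (f : (Fin n → ℂ) → ℂ) (f' : ℂ) (z : Fin n → ℂ) :
    Prop where
  differentiableAt : DifferentiableAt ℝ f z
  eq : (fderiv ℝ f z (Pi.single j 1) + c * fderiv ℝ f z (Pi.single j Complex.I)) / 2 = f'

namespace HasWirtingerAt

theorem wirtinger_eq (h : HasWirtingerAt (-Complex.I) j f f' z) : wirtinger j f z = f' := by
  rw [← h.eq, wirtinger, neg_mul, sub_eq_add_neg]

theorem wirtingerBar_eq (h : HasWirtingerAt Complex.I j f f' z) : wirtingerBar j f z = f' :=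
  h.eq

theorem congr_of_eventuallyEq (h : HasWirtingerAt c j f f' z) (hgf : g =ᶠ[𝓝 z] f) :
    HasWirtingerAt c j g f' z :=
  ⟨h.differentiableAt.congr_of_eventuallyEq hgf, by rw [hgf.fderiv_eq, h.eq]⟩

theorem const (a : ℂ) : HasWirtingerAt c j (fun _ => a) 0 z :=
  ⟨differentiableAt_const a, by
    simp only [fderiv_const_apply, zero_apply, mul_zero, add_zero, zero_div]⟩

theorem add (hf : HasWirtingerAt c j f f' z) (hg : HasWirtingerAt c j g g' z) :
    HasWirtingerAt c j (fun t => f t + g t) (f' + g') z := by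
  refine ⟨hf.1.add hg.1, ?_⟩
  rw [fderiv_fun_add hf.1 hg.1, ← hf.eq, ← hg.eq]
  simp only [add_apply]
  ring

theorem mul (hf : HasWirtingerAt c j f f' z) (hg : HasWirtingerAt c j g g' z) :
    HasWirtingerAt c j (fun t => f t * g t) (f' * g z + f z * g') z := by
  refine ⟨hf.1.mul hg.1, ?_⟩
  rw [fderiv_fun_mul hf.1 hg.1, ← hf.eq, ← hg.eq]
  simp only [add_apply, smul_apply, smul_eq_mul]
  ring

theorem const_mul (a : ℂ) (hf : HasWirtingerAt c j f f' z) :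
    HasWirtingerAt c j (fun t => a * f t) (a * f') z := by
  simpa only [zero_mul, zero_add] using (const a).mul hf

theorem comp {φ : ℂ → ℂ} {φ' : ℂ} (hφ : HasDerivAt φ φ' (f z)) (hf : HasWirtingerAt c j f f' z) :
    HasWirtingerAt c j (fun t => φ (f t)) (φ' * f') z := by
  have hcomp : HasFDerivAt (fun t => φ (f t)) _ z :=
    (hφ.hasFDerivAt.restrictScalars ℝ).comp z hf.1.hasFDerivAt
  refine ⟨hcomp.differentiableAt, ?_⟩
  rw [hcomp.fderiv, ← hf.eq]
  simp only [ContinuousLinearMap.comp_apply, ContinuousLinearMap.coe_restrictScalars',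
    ContinuousLinearMap.toSpanSingleton_apply, smul_eq_mul]
  ring

theorem sum {ι : Type*} {s : Finset ι} {f : ι → (Fin n → ℂ) → ℂ} {f' : ι → ℂ}
    (h : ∀ i ∈ s, HasWirtingerAt c j (f i) (f' i) z) :
    HasWirtingerAt c j (fun t => ∑ i ∈ s, f i t) (∑ i ∈ s, f' i) z := by
  refine ⟨DifferentiableAt.fun_sum fun i hi => (h i hi).1, ?_⟩
  rw [fderiv_fun_sum fun i hi => (h i hi).1, ← Finset.sum_congr rfl fun i hi => (h i hi).eq]
  simp only [sum_apply, Finset.mul_sum, ← Finset.sum_add_distrib, Finset.sum_div]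

theorem dotProduct {ι : Type*} [Fintype ι] {u v : (Fin n → ℂ) → ι → ℂ} {u' v' : ι → ℂ}
    (hu : ∀ i, HasWirtingerAt c j (fun t => u t i) (u' i) z)
    (hv : ∀ i, HasWirtingerAt c j (fun t => v t i) (v' i) z) :
    HasWirtingerAt c j (fun t => u t ⬝ᵥ v t) (u' ⬝ᵥ v z + u z ⬝ᵥ v') z := by
  simp only [_root_.dotProduct, ← Finset.sum_add_distrib]
  exact sum fun i _ => (hu i).mul (hv i)

theorem ofReal_log_re (hf : HasWirtingerAt c j f f' z)
    (hpos : ∀ᶠ t in 𝓝 z, ∃ x : ℝ, 0 < x ∧ f t = x) :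
    HasWirtingerAt c j (fun t => (Real.log (f t).re : ℂ)) (f' / f z) z := by
  obtain ⟨x, hx, hfx⟩ := hpos.self_of_nhds
  have hslit : f z ∈ Complex.slitPlane := hfx ▸ Complex.ofReal_mem_slitPlane.2 hx
  rw [div_eq_inv_mul]
  refine (hf.comp (Complex.hasDerivAt_log hslit)).congr_of_eventuallyEq ?_
  filter_upwards [hpos] with t ⟨y, hy, hfy⟩
  rw [hfy, Complex.ofReal_re, Complex.ofReal_log hy.le]

end HasWirtingerAt

theorem single_I_eq_smul (j : Fin n) :
    (Pi.single j Complex.I : Fin n → ℂ) = Complex.I • Pi.single j 1 := by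
  rw [← Pi.single_smul', smul_eq_mul, mul_one]

theorem hasWirtingerAt_neg_I_of_differentiableAt (hf : DifferentiableAt ℂ f z) :
    HasWirtingerAt (-Complex.I) j f (fderiv ℂ f z (Pi.single j 1)) z := by
  have hℝ := hf.hasFDerivAt.restrictScalars ℝ
  refine ⟨hℝ.differentiableAt, ?_⟩
  rw [hℝ.fderiv, ContinuousLinearMap.coe_restrictScalars', single_I_eq_smul, map_smul, smul_eq_mul]
  linear_combination -(fderiv ℂ f z (Pi.single j 1)) / 2 * Complex.I_mul_I

theorem hasWirtingerAt_I_of_differentiableAt (hf : DifferentiableAt ℂ f z) :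
    HasWirtingerAt Complex.I j f 0 z := by
  have hℝ := hf.hasFDerivAt.restrictScalars ℝ
  refine ⟨hℝ.differentiableAt, ?_⟩
  rw [hℝ.fderiv, ContinuousLinearMap.coe_restrictScalars', single_I_eq_smul, map_smul, smul_eq_mul]
  linear_combination (fderiv ℂ f z (Pi.single j 1)) / 2 * Complex.I_mul_I

theorem HasWirtingerAt.conj (hf : HasWirtingerAt c j f f' z) :
    HasWirtingerAt (starRingEnd ℂ c) j (fun t => starRingEnd ℂ (f t)) (starRingEnd ℂ f') z := by
  have hconj : HasFDerivAt (fun t => starRingEnd ℂ (f t)) _ z :=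
    Complex.conjCLE.toContinuousLinearMap.hasFDerivAt.comp z hf.1.hasFDerivAt
  refine ⟨hconj.differentiableAt, ?_⟩
  rw [hconj.fderiv, ← hf.eq]
  simp only [ContinuousLinearMap.comp_apply, ContinuousLinearEquiv.coe_coe,
    Complex.conjCLE_apply, map_div₀, map_add, map_mul, Complex.conj_ofNat]

theorem hasWirtingerAt_neg_I_conj_of_differentiableAt (hf : DifferentiableAt ℂ f z) :
    HasWirtingerAt (-Complex.I) j (fun t => starRingEnd ℂ (f t)) 0 z := by
  simpa only [Complex.conj_I, map_zero] using (hasWirtingerAt_I_of_differentiableAt hf).conj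

theorem hasWirtingerAt_I_conj_of_differentiableAt (hf : DifferentiableAt ℂ f z) :
    HasWirtingerAt Complex.I j (fun t => starRingEnd ℂ (f t))
      (starRingEnd ℂ (fderiv ℂ f z (Pi.single j 1))) z := by
  simpa only [map_neg, Complex.conj_I, neg_neg] using
    (hasWirtingerAt_neg_I_of_differentiableAt hf).conj

theorem hasDerivAt_inv_one_sub_pow {x : ℂ} (hx : 1 - x ≠ 0) (m : ℕ) :
    HasDerivAt (fun x : ℂ => ((1 - x) ^ m)⁻¹) (((1 - x) ^ m)⁻¹ * (m / (1 - x))) x := by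
  refine ((((hasDerivAt_id x).const_sub 1).fun_pow m).fun_inv (pow_ne_zero m hx)).congr_deriv ?_
  rcases m with _ | m
  · simp only [Nat.cast_zero, zero_mul, zero_div, neg_zero, mul_zero]
  · rw [id, add_tsub_cancel_right]
    field_simp
    ring

section Sesquiholomorphic

variable {m : ℕ} {ι : Type*} [Fintype ι] {u v : (Fin n → ℂ) → ι → ℂ}

theorem hasWirtingerAt_neg_I_dotProduct_star (hu : DifferentiableAt ℂ u z)
    (hv : DifferentiableAt ℂ v z) :
    HasWirtingerAt (-Complex.I) j (fun t => u t ⬝ᵥ star (v t))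
      (fderiv ℂ u z (Pi.single j 1) ⬝ᵥ star (v z)) z := by
  have hui (i : ι) := hasWirtingerAt_neg_I_of_differentiableAt (j := j)
    (differentiableAt_pi.1 hu i)
  have hvi (i : ι) := hasWirtingerAt_neg_I_conj_of_differentiableAt (j := j)
    (differentiableAt_pi.1 hv i)
  simp only [fderiv_apply hu] at hui
  simpa only [← Pi.zero_def, dotProduct_zero, add_zero] using
    HasWirtingerAt.dotProduct (v := fun t => star (v t))
      (u' := fderiv ℂ u z (Pi.single j 1)) hui hvi

theorem hasWirtingerAt_I_dotProduct_star (hu : DifferentiableAt ℂ u z)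
    (hv : DifferentiableAt ℂ v z) :
    HasWirtingerAt Complex.I j (fun t => u t ⬝ᵥ star (v t))
      (u z ⬝ᵥ star (fderiv ℂ v z (Pi.single j 1))) z := by
  have hui (i : ι) := hasWirtingerAt_I_of_differentiableAt (j := j)
    (differentiableAt_pi.1 hu i)
  have hvi (i : ι) := hasWirtingerAt_I_conj_of_differentiableAt (j := j)
    (differentiableAt_pi.1 hv i)
  simp only [fderiv_apply hv] at hvi
  simpa only [← Pi.zero_def, zero_dotProduct, zero_add] using
    HasWirtingerAt.dotProduct (v := fun t => star (v t))
      (v' := star (fderiv ℂ v z (Pi.single j 1))) hui hvi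

theorem hasWirtingerAt_neg_I_mul_conj_mul_inv_one_sub_pow (a : ℂ) (hf : DifferentiableAt ℂ f z)
    (hg : DifferentiableAt ℂ g z) (hu : DifferentiableAt ℂ u z) (hv : DifferentiableAt ℂ v z)
    (hfz : f z ≠ 0) (huv : 1 - u z ⬝ᵥ star (v z) ≠ 0) :
    HasWirtingerAt (-Complex.I) j
      (fun t => a * f t * starRingEnd ℂ (g t) * ((1 - u t ⬝ᵥ star (v t)) ^ m)⁻¹)
      (a * f z * starRingEnd ℂ (g z) * ((1 - u z ⬝ᵥ star (v z)) ^ m)⁻¹ *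
        (fderiv ℂ f z (Pi.single j 1) / f z +
          m * (fderiv ℂ u z (Pi.single j 1) ⬝ᵥ star (v z)) / (1 - u z ⬝ᵥ star (v z)))) z := by
  have hprod := (((hasWirtingerAt_neg_I_of_differentiableAt (j := j) hf).const_mul a).mul
    (hasWirtingerAt_neg_I_conj_of_differentiableAt hg)).mul
      ((hasWirtingerAt_neg_I_dotProduct_star hu hv).comp (hasDerivAt_inv_one_sub_pow huv m))
  convert hprod using 1
  field_simp
  ring

theorem hasWirtingerAt_I_mul_conj_mul_inv_one_sub_pow (a : ℂ) (hf : DifferentiableAt ℂ f z)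
    (hg : DifferentiableAt ℂ g z) (hu : DifferentiableAt ℂ u z) (hv : DifferentiableAt ℂ v z)
    (hgz : g z ≠ 0) (huv : 1 - u z ⬝ᵥ star (v z) ≠ 0) :
    HasWirtingerAt Complex.I j
      (fun t => a * f t * starRingEnd ℂ (g t) * ((1 - u t ⬝ᵥ star (v t)) ^ m)⁻¹)
      (a * f z * starRingEnd ℂ (g z) * ((1 - u z ⬝ᵥ star (v z)) ^ m)⁻¹ *
        (starRingEnd ℂ (fderiv ℂ g z (Pi.single j 1) / g z) +
          m * (u z ⬝ᵥ star (fderiv ℂ v z (Pi.single j 1))) / (1 - u z ⬝ᵥ star (v z)))) z := by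
  have hgz' : starRingEnd ℂ (g z) ≠ 0 := (map_ne_zero _).2 hgz
  have hprod := (((hasWirtingerAt_I_of_differentiableAt (j := j) hf).const_mul a).mul
    (hasWirtingerAt_I_conj_of_differentiableAt hg)).mul
      ((hasWirtingerAt_I_dotProduct_star hu hv).comp (hasDerivAt_inv_one_sub_pow huv m))
  convert hprod using 1
  rw [map_div₀]
  field_simp
  ring

end Sesquiholomorphic

end Wirtinger

/-! ### Bergman invariants of a domain biholomorphic to the unit ball -/

section BallModel

variable {n : ℕ} {F G : (Fin n → ℂ) → (Fin n → ℂ)} {Ω : Set (Fin n → ℂ)} {p t z : Fin n → ℂ}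

namespace IsBiholomorphism

theorem bergmanKernel_ne_zero (h : IsBiholomorphism F G Ω (euclideanBall 0 1)) (hΩ : IsOpen Ω)
    (hz : z ∈ Ω) (ht : t ∈ Ω) : bergmanKernel Ω z t ≠ 0 := by
  have hB := isOpen_euclideanBall (0 : Fin n → ℂ) 1
  have hV : (volume.real (euclideanBall (0 : Fin n → ℂ) 1) : ℂ) ≠ 0 := by
    exact_mod_cast volume_real_unitBall_pos.ne'
  rw [h.bergmanKernel_eq_of_unitBall hΩ hz ht]
  exact mul_ne_zero (mul_ne_zero (mul_ne_zero (inv_ne_zero hV)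
    (h.complexJacobian_ne_zero hΩ hB hz)) ((map_ne_zero _).2 (h.complexJacobian_ne_zero hΩ hB ht)))
    (inv_ne_zero (pow_ne_zero _ (one_sub_dotProduct_star_ne_zero (h.mapsTo hz) (h.mapsTo ht))))

theorem exists_pos_bergmanKernel_self_eq (h : IsBiholomorphism F G Ω (euclideanBall 0 1))
    (hΩ : IsOpen Ω) (ht : t ∈ Ω) : ∃ x : ℝ, 0 < x ∧ bergmanKernel Ω t t = x := by
  have hJ := norm_pos_iff.2 (h.complexJacobian_ne_zero hΩ (isOpen_euclideanBall 0 1) ht)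
  have hV := volume_real_unitBall_pos (n := n)
  have hF : 0 < 1 - ‖WithLp.toLp 2 (F t)‖ ^ 2 :=
    sub_pos.2 (pow_lt_one₀ (norm_nonneg _) (mem_unitBall.1 (h.mapsTo ht)) two_ne_zero)
  refine ⟨(volume.real (euclideanBall (0 : Fin n → ℂ) 1))⁻¹ * ‖complexJacobian F t‖ ^ 2 *
    ((1 - ‖WithLp.toLp 2 (F t)‖ ^ 2) ^ (n + 1))⁻¹, by positivity, ?_⟩
  rw [h.bergmanKernel_eq_of_unitBall hΩ ht ht, dotProduct_star_self,
    mul_assoc _ (complexJacobian F t), Complex.mul_conj']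
  push_cast
  rfl

variable (j : Fin n)

theorem wirtinger_bergmanKernel (h : IsBiholomorphism F G Ω (euclideanBall 0 1)) (hΩ : IsOpen Ω)
    (hz : z ∈ Ω) (ht : t ∈ Ω) :
    wirtinger j (fun ζ => bergmanKernel Ω ζ t) z = bergmanKernel Ω z t *
      (fderiv ℂ (complexJacobian F) z (Pi.single j 1) / complexJacobian F z +
        (n + 1 : ℕ) * (fderiv ℂ F z (Pi.single j 1) ⬝ᵥ star (F t)) /
          (1 - F z ⬝ᵥ star (F t))) := by
  have hJ := (differentiableOn_complexJacobian hΩ h.holomorphic).differentiableAt (hΩ.mem_nhds hz)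
  have hformula := hasWirtingerAt_neg_I_mul_conj_mul_inv_one_sub_pow (j := j) (m := n + 1)
    (volume.real (euclideanBall (0 : Fin n → ℂ) 1) : ℂ)⁻¹ hJ
    (differentiableAt_const (complexJacobian F t)) (h.differentiableAt hΩ hz)
    (differentiableAt_const (F t)) (h.complexJacobian_ne_zero hΩ (isOpen_euclideanBall 0 1) hz)
    (one_sub_dotProduct_star_ne_zero (h.mapsTo hz) (h.mapsTo ht))
  rw [h.bergmanKernel_eq_of_unitBall hΩ hz ht]
  refine (hformula.congr_of_eventuallyEq ?_).wirtinger_eq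
  filter_upwards [hΩ.mem_nhds hz] with ζ hζ using h.bergmanKernel_eq_of_unitBall hΩ hζ ht

theorem wirtingerBar_bergmanKernel (h : IsBiholomorphism F G Ω (euclideanBall 0 1))
    (hΩ : IsOpen Ω) (hz : z ∈ Ω) (ht : t ∈ Ω) :
    wirtingerBar j (fun τ => bergmanKernel Ω z τ) t = bergmanKernel Ω z t *
      (starRingEnd ℂ (fderiv ℂ (complexJacobian F) t (Pi.single j 1) / complexJacobian F t) +
        (n + 1 : ℕ) * (F z ⬝ᵥ star (fderiv ℂ F t (Pi.single j 1))) /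
          (1 - F z ⬝ᵥ star (F t))) := by
  have hJ := (differentiableOn_complexJacobian hΩ h.holomorphic).differentiableAt (hΩ.mem_nhds ht)
  have hformula := hasWirtingerAt_I_mul_conj_mul_inv_one_sub_pow (j := j) (m := n + 1)
    (volume.real (euclideanBall (0 : Fin n → ℂ) 1) : ℂ)⁻¹
    (differentiableAt_const (complexJacobian F z)) hJ (differentiableAt_const (F z))
    (h.differentiableAt hΩ ht) (h.complexJacobian_ne_zero hΩ (isOpen_euclideanBall 0 1) ht)
    (one_sub_dotProduct_star_ne_zero (h.mapsTo hz) (h.mapsTo ht))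
  rw [h.bergmanKernel_eq_of_unitBall hΩ hz ht]
  refine (hformula.congr_of_eventuallyEq ?_).wirtingerBar_eq
  filter_upwards [hΩ.mem_nhds ht] with τ hτ using h.bergmanKernel_eq_of_unitBall hΩ hz hτ

theorem wirtingerBar_logBergmanDiag (h : IsBiholomorphism F G Ω (euclideanBall 0 1))
    (hΩ : IsOpen Ω) (ht : t ∈ Ω) :
    wirtingerBar j (logBergmanDiag Ω) t =
      starRingEnd ℂ (fderiv ℂ (complexJacobian F) t (Pi.single j 1) / complexJacobian F t) +
        (n + 1 : ℕ) * (F t ⬝ᵥ star (fderiv ℂ F t (Pi.single j 1))) /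
          (1 - F t ⬝ᵥ star (F t)) := by
  have hJ := (differentiableOn_complexJacobian hΩ h.holomorphic).differentiableAt (hΩ.mem_nhds ht)
  have hformula := hasWirtingerAt_I_mul_conj_mul_inv_one_sub_pow (j := j) (m := n + 1)
    (volume.real (euclideanBall (0 : Fin n → ℂ) 1) : ℂ)⁻¹ hJ hJ
    (h.differentiableAt hΩ ht) (h.differentiableAt hΩ ht)
    (h.complexJacobian_ne_zero hΩ (isOpen_euclideanBall 0 1) ht)
    (one_sub_dotProduct_star_ne_zero (h.mapsTo ht) (h.mapsTo ht))
  have hdiag := hformula.congr_of_eventuallyEq (g := fun τ => bergmanKernel Ω τ τ) <| by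
    filter_upwards [hΩ.mem_nhds ht] with τ hτ using h.bergmanKernel_eq_of_unitBall hΩ hτ hτ
  refine ((hdiag.ofReal_log_re ?_).wirtingerBar_eq).trans ?_
  · filter_upwards [hΩ.mem_nhds ht] with τ hτ using h.exists_pos_bergmanKernel_self_eq hΩ hτ
  · rw [← h.bergmanKernel_eq_of_unitBall hΩ ht ht,
      mul_div_cancel_left₀ _ (h.bergmanKernel_ne_zero hΩ ht ht)]

end IsBiholomorphism

end BallModel

/-! ### The Bergman metric and representative coordinate at the center -/

section RepresentativeCoordinate

variable {n : ℕ} {F G : (Fin n → ℂ) → (Fin n → ℂ)} {Ω : Set (Fin n → ℂ)} {p w z : Fin n → ℂ}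

namespace IsBiholomorphism

theorem bergmanMetric_eq (h : IsBiholomorphism F G Ω (euclideanBall 0 1)) (hΩ : IsOpen Ω)
    (hp : p ∈ Ω) (hFp : F p = 0) :
    bergmanMetric Ω p = ((n + 1 : ℕ) : ℂ) • ((jacobianMatrix F p)ᴴ * jacobianMatrix F p)ᵀ := by
  ext α β
  have hF := h.differentiableAt hΩ hp
  have hF' : DifferentiableAt ℂ (fun τ => fderiv ℂ F τ (Pi.single β 1)) p :=
    (differentiableOn_fderiv_apply hΩ h.holomorphic _).differentiableAt (hΩ.mem_nhds hp)
  have hJ := differentiableOn_complexJacobian hΩ h.holomorphic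
  have hlogJ : DifferentiableAt ℂ
      (fun τ => fderiv ℂ (complexJacobian F) τ (Pi.single β 1) / complexJacobian F τ) p := by
    simp only [div_eq_mul_inv]
    exact ((differentiableOn_fderiv_apply hΩ hJ _).differentiableAt (hΩ.mem_nhds hp)).mul
      ((hJ.differentiableAt (hΩ.mem_nhds hp)).inv
        (h.complexJacobian_ne_zero hΩ (isOpen_euclideanBall 0 1) hp))
  have hF0 : 1 - F p ⬝ᵥ star (F p) ≠ 0 :=
    one_sub_dotProduct_star_ne_zero (h.mapsTo hp) (h.mapsTo hp)
  have hformula := (hasWirtingerAt_neg_I_conj_of_differentiableAt (j := α) hlogJ).add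
    (((hasWirtingerAt_neg_I_dotProduct_star hF hF').const_mul ((n + 1 : ℕ) : ℂ)).mul
      ((hasWirtingerAt_neg_I_dotProduct_star hF hF).comp (hasDerivAt_inv_one_sub_pow hF0 1)))
  refine ((hformula.congr_of_eventuallyEq ?_).wirtinger_eq).trans ?_
  · filter_upwards [hΩ.mem_nhds hp] with τ hτ
    rw [h.wirtingerBar_logBergmanDiag β hΩ hτ, pow_one, div_eq_mul_inv (_ * _)]
  · simp only [hFp, star_zero, dotProduct_zero, zero_dotProduct, mul_zero, sub_zero, one_pow,
      inv_one, mul_one, add_zero, zero_add, Matrix.smul_apply, Matrix.transpose_apply,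
      Matrix.mul_apply, Matrix.conjTranspose_apply, jacobianMatrix_apply, smul_eq_mul]
    rw [dotProduct_comm]
    rfl

theorem det_bergmanMetric_ne_zero (h : IsBiholomorphism F G Ω (euclideanBall 0 1)) (hΩ : IsOpen Ω)
    (hp : p ∈ Ω) (hFp : F p = 0) : (bergmanMetric Ω p).det ≠ 0 := by
  have hJ := h.complexJacobian_ne_zero hΩ (isOpen_euclideanBall 0 1) hp
  rw [h.bergmanMetric_eq hΩ hp hFp, Matrix.det_smul, Matrix.det_transpose, Matrix.det_mul,
    Matrix.det_conjTranspose, det_jacobianMatrix]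
  exact mul_ne_zero (pow_ne_zero _ (Nat.cast_ne_zero.2 n.succ_ne_zero))
    (mul_ne_zero (star_ne_zero.2 hJ) hJ)

theorem bergmanRep_eq (h : IsBiholomorphism F G Ω (euclideanBall 0 1)) (hΩ : IsOpen Ω)
    (hp : p ∈ Ω) (hFp : F p = 0) (hz : z ∈ Ω) :
    bergmanRep Ω p z = fderiv ℂ G 0 (F z) := by
  have hFG : fderiv ℂ F p (fderiv ℂ G 0 (F z)) = F z := by
    simpa only [hFp] using h.fderiv_fderiv_inv hΩ (isOpen_euclideanBall 0 1) hp (F z)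
  have hdiff (j : Fin n) :
      (bergmanKernel Ω z p)⁻¹ * wirtingerBar j (fun t => bergmanKernel Ω z t) p -
        wirtingerBar j (logBergmanDiag Ω) p = (fderiv ℂ G 0 (F z) ᵥ* bergmanMetric Ω p) j := by
    rw [h.wirtingerBar_bergmanKernel j hΩ hz hp, h.wirtingerBar_logBergmanDiag j hΩ hp,
      inv_mul_cancel_left₀ (h.bergmanKernel_ne_zero hΩ hz hp), h.bergmanMetric_eq hΩ hp hFp, hFp,
      Matrix.vecMul_smul, Matrix.vecMul_transpose, ← Matrix.mulVec_mulVec,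
      jacobianMatrix_mulVec, hFG]
    simp only [star_zero, dotProduct_zero, zero_dotProduct, mul_zero, sub_zero, div_one, add_zero,
      add_sub_cancel_left, Pi.smul_apply, smul_eq_mul, dotProduct_comm (F z)]
    rfl
  ext α
  have hdet : IsUnit (bergmanMetric Ω p).det := (h.det_bergmanMetric_ne_zero hΩ hp hFp).isUnit
  simp only [bergmanRep, hdiff, mul_comm ((bergmanMetric Ω p)⁻¹ _ α)]
  change ((_ ᵥ* bergmanMetric Ω p) ᵥ* (bergmanMetric Ω p)⁻¹) α = _
  rw [Matrix.vecMul_vecMul, Matrix.mul_nonsing_inv _ hdet, Matrix.vecMul_one]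

theorem mem_bergmanBall_iff (h : IsBiholomorphism F G Ω (euclideanBall 0 1)) (hΩ : IsOpen Ω)
    (hp : p ∈ Ω) (hFp : F p = 0) :
    w ∈ bergmanBall Ω p ↔ fderiv ℂ F p w ∈ euclideanBall 0 1 := by
  have hquad : ∑ α, ∑ β, w α * bergmanMetric Ω p α β * starRingEnd ℂ (w β) =
      (((n + 1) * ‖WithLp.toLp 2 (fderiv ℂ F p w)‖ ^ 2 : ℝ) : ℂ) := by
    calc
      _ = w ⬝ᵥ (bergmanMetric Ω p *ᵥ star w) := by
        simp only [dotProduct, Matrix.mulVec, Finset.mul_sum, mul_assoc]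
        rfl
      _ = (n + 1 : ℕ) * (fderiv ℂ F p w ⬝ᵥ star (fderiv ℂ F p w)) := by
        rw [h.bergmanMetric_eq hΩ hp hFp, Matrix.smul_mulVec, Matrix.mulVec_transpose,
          ← Matrix.vecMul_vecMul, ← Matrix.star_mulVec, dotProduct_smul, dotProduct_comm w,
          ← Matrix.dotProduct_mulVec, jacobianMatrix_mulVec, dotProduct_comm, smul_eq_mul]
      _ = _ := by
        rw [dotProduct_star_self]
        push_cast
        rfl
  rw [bergmanBall, mem_ofPred_eq, hquad, Complex.ofReal_re, mem_unitBall,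
    mul_lt_iff_lt_one_right (by positivity), sq_lt_one_iff₀ (norm_nonneg _)]

theorem isBiholomorphism_fderiv_inv (h : IsBiholomorphism F G Ω (euclideanBall 0 1))
    (hΩ : IsOpen Ω) (hp : p ∈ Ω) (hFp : F p = 0) :
    IsBiholomorphism (fderiv ℂ G 0) (fderiv ℂ F p) (euclideanBall 0 1) (bergmanBall Ω p) := by
  have hB := isOpen_euclideanBall (0 : Fin n → ℂ) 1
  have hFG (w : Fin n → ℂ) : fderiv ℂ F p (fderiv ℂ G 0 w) = w := by
    simpa only [hFp] using h.fderiv_fderiv_inv hΩ hB hp w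
  have hGF (w : Fin n → ℂ) : fderiv ℂ G 0 (fderiv ℂ F p w) = w := by
    simpa only [hFp] using h.fderiv_inv_fderiv hΩ hB hp w
  exact
    { mapsTo := fun w hw => (h.mem_bergmanBall_iff hΩ hp hFp).2 ((hFG w).symm ▸ hw)
      mapsTo_inv := fun w hw => (h.mem_bergmanBall_iff hΩ hp hFp).1 hw
      invOn := ⟨fun w _ => hFG w, fun w _ => hGF w⟩
      holomorphic := (fderiv ℂ G 0).differentiableOn
      holomorphic_inv := (fderiv ℂ F p).differentiableOn }

theorem isBiholomorphism_bergmanRep (h : IsBiholomorphism F G Ω (euclideanBall 0 1))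
    (hΩ : IsOpen Ω) (hp : p ∈ Ω) (hFp : F p = 0) :
    IsBiholomorphism (bergmanRep Ω p) (G ∘ fderiv ℂ F p) Ω (bergmanBall Ω p) :=
  (h.trans (h.isBiholomorphism_fderiv_inv hΩ hp hFp)).congr
    (fun _ hz => h.bergmanRep_eq hΩ hp hFp hz) (eqOn_refl _ _)

end IsBiholomorphism

end RepresentativeCoordinate

/-! ### Boundary regularity of the inverse map -/

section BoundaryRegularity

theorem exists_ne_zero_forall_single_mem_of_mem_nhds_zero {ι R : Type*} [Finite ι] [DecidableEq ι]
    [Zero R] [TopologicalSpace R] [(𝓝[≠] (0 : R)).NeBot] {s : Set (ι → R)} (hs : s ∈ 𝓝 0) :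
    ∃ δ : R, δ ≠ 0 ∧ ∀ k, Pi.single k δ ∈ s := by
  have hsingle (k : ι) : Tendsto (fun δ : R => (Pi.single k δ : ι → R)) (𝓝 0) (𝓝 0) :=
    (continuous_single k).tendsto' 0 0 (Pi.single_zero k)
  have hmem : ∀ᶠ δ : R in 𝓝[≠] 0, δ ≠ 0 ∧ ∀ k, Pi.single k δ ∈ s :=
    eventually_mem_nhdsWithin.and
      (nhdsWithin_le_nhds (eventually_all.2 fun k => hsingle k hs))
  exact hmem.exists

theorem norm_matrix_inv_apply_le {ι 𝕜 : Type*} [Fintype ι] [DecidableEq ι] [NormedField 𝕜]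
    {A : Matrix ι ι 𝕜} {M c : ℝ} (hM : 1 ≤ M) (hc : 0 < c) (hA : ∀ i j, ‖A i j‖ ≤ M)
    (hdet : c ≤ ‖A.det‖) (i j : ι) :
    ‖A⁻¹ i j‖ ≤ c⁻¹ * ((Fintype.card ι).factorial * M ^ Fintype.card ι) := by
  have hentry (k l : ι) : ‖A.updateRow j (Pi.single i 1) k l‖ ≤ M := by
    rw [Matrix.updateRow_apply, Pi.single_apply]
    split_ifs
    · rwa [norm_one]
    · rw [norm_zero]
      exact zero_le_one.trans hM
    · exact hA k l
  have hadj : ‖A.adjugate i j‖ ≤ (Fintype.card ι).factorial * M ^ Fintype.card ι := by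
    rw [Matrix.adjugate_apply, ← nsmul_eq_mul]
    exact Matrix.det_le (abv := NormedField.toAbsoluteValue 𝕜) hentry
  rw [Matrix.inv_def, Matrix.smul_apply, smul_eq_mul, norm_mul, Ring.inverse_eq_inv', norm_inv]
  exact mul_le_mul (inv_anti₀ hc hdet) hadj (norm_nonneg _) (inv_nonneg.2 hc.le)

theorem opNorm_le_card_mul_of_norm_apply_single_le {ι 𝕜 E : Type*} [Fintype ι] [DecidableEq ι]
    [NontriviallyNormedField 𝕜] [SeminormedAddCommGroup E] [NormedSpace 𝕜 E]
    {L : (ι → 𝕜) →L[𝕜] E} {R : ℝ} (hR : 0 ≤ R) (hL : ∀ i, ‖L (Pi.single i 1)‖ ≤ R) :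
    ‖L‖ ≤ Fintype.card ι * R := by
  refine L.opNorm_le_bound (by positivity) fun v => ?_
  calc ‖L v‖ = ‖∑ i, v i • L (Pi.single i 1)‖ := by
        conv_lhs => rw [pi_eq_sum_univ' v, map_sum]
        simp only [map_smul]
    _ ≤ ∑ _i : ι, ‖v‖ * R := norm_sum_le_of_le _ fun i _ => by
        rw [norm_smul]
        exact mul_le_mul (norm_le_pi_norm v i) (hL i) (norm_nonneg _) (norm_nonneg _)
    _ = Fintype.card ι * R * ‖v‖ := by
        rw [Finset.sum_const, Finset.card_univ, nsmul_eq_mul, mul_assoc, mul_comm R]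

variable {n : ℕ} {F G : (Fin n → ℂ) → (Fin n → ℂ)} {Ω U : Set (Fin n → ℂ)} {p t z : Fin n → ℂ}

theorem isBiholomorphism_smul_sub (a : Fin n → ℂ) {r : ℝ} (hr : 0 < r) :
    IsBiholomorphism (fun z => (r : ℂ)⁻¹ • (z - a)) (fun w => (r : ℂ) • w + a)
      (euclideanBall a r) (euclideanBall 0 1) where
  mapsTo z hz := by
    rw [euclideanBall_eq_preimage, mem_preimage, mem_ball, dist_eq_norm, ← WithLp.toLp_sub,
      abs_of_pos hr] at hz
    rwa [mem_unitBall, WithLp.toLp_smul, norm_smul, norm_inv, Complex.norm_real,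
      Real.norm_of_nonneg hr.le, inv_mul_lt_one₀ hr]
  mapsTo_inv w hw := by
    rw [mem_unitBall] at hw
    rw [euclideanBall_eq_preimage, mem_preimage, mem_ball, dist_eq_norm, ← WithLp.toLp_sub,
      abs_of_pos hr, add_sub_cancel_right, WithLp.toLp_smul, norm_smul, Complex.norm_real,
      Real.norm_of_nonneg hr.le]
    exact mul_lt_of_lt_one_right hr hw
  invOn := by
    have hr0 : (r : ℂ) ≠ 0 := Complex.ofReal_ne_zero.2 hr.ne'
    refine ⟨fun z _ => ?_, fun w _ => ?_⟩
    · simp only [smul_inv_smul₀ hr0, sub_add_cancel]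
    · simp only [add_sub_cancel_right, inv_smul_smul₀ hr0]
  holomorphic := by fun_prop
  holomorphic_inv := by fun_prop

namespace IsBiholomorphism

theorem exists_unitBall_apply_eq_zero {a : Fin n → ℂ} {r : ℝ}
    (h : IsBiholomorphism F G Ω (euclideanBall a r)) (hr : 0 < r) (hp : p ∈ Ω) :
    ∃ F' G', IsBiholomorphism F' G' Ω (euclideanBall 0 1) ∧ F' p = 0 := by
  have h₁ := h.trans (isBiholomorphism_smul_sub a hr)
  exact ⟨_, _, h₁.trans (isBiholomorphism_ballInvolution (h₁.mapsTo hp)),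
    ballInvolution_self (h₁.mapsTo hp)⟩

theorem norm_fderiv_dotProduct_star_le (h : IsBiholomorphism F G Ω (euclideanBall 0 1))
    (hΩ : IsOpen Ω) (hp : p ∈ Ω) (hFp : F p = 0) (ht : t ∈ Ω) (hz : z ∈ Ω) {C : ℝ} {j : Fin n}
    (hCp : ‖wirtinger j (fun ζ => bergmanKernel Ω ζ p) z‖ ≤ C * ‖bergmanKernel Ω z p‖)
    (hCt : ‖wirtinger j (fun ζ => bergmanKernel Ω ζ t) z‖ ≤ C * ‖bergmanKernel Ω z t‖) :
    ‖fderiv ℂ F z (Pi.single j 1) ⬝ᵥ star (F t)‖ ≤ 4 * C := by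
  have hpos {s : Fin n → ℂ} (hs : s ∈ Ω) := norm_pos_iff.2 (h.bergmanKernel_ne_zero hΩ hz hs)
  rw [h.wirtinger_bergmanKernel j hΩ hz hp, norm_mul, mul_comm, mul_le_mul_iff_left₀ (hpos hp),
    hFp, star_zero, dotProduct_zero, mul_zero, zero_div, add_zero] at hCp
  rw [h.wirtinger_bergmanKernel j hΩ hz ht, norm_mul, mul_comm,
    mul_le_mul_iff_left₀ (hpos ht)] at hCt
  set x := fderiv ℂ F z (Pi.single j 1) ⬝ᵥ star (F t)
  set d := 1 - F z ⬝ᵥ star (F t)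
  have hd0 : 0 < ‖d‖ :=
    norm_pos_iff.2 (one_sub_dotProduct_star_ne_zero (h.mapsTo hz) (h.mapsTo ht))
  have hd2 : ‖d‖ ≤ 2 := by
    have hinner : ‖F z ⬝ᵥ star (F t)‖ ≤ 1 := (norm_dotProduct_star_le _ _).trans
      (mul_le_one₀ (mem_unitBall.1 (h.mapsTo ht)).le (norm_nonneg _)
        (mem_unitBall.1 (h.mapsTo hz)).le)
    calc ‖d‖ ≤ ‖(1 : ℂ)‖ + ‖F z ⬝ᵥ star (F t)‖ := norm_sub_le _ _
      _ ≤ 2 := by rw [norm_one]; linarith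
  have hdiff : ‖(n + 1 : ℕ) * x / d‖ ≤ C + C := by
    simpa only [add_sub_cancel_left] using norm_sub_le_of_le hCt hCp
  have hC : 0 ≤ C + C := (norm_nonneg _).trans hdiff
  calc ‖x‖ ≤ (n + 1 : ℕ) * ‖x‖ :=
        le_mul_of_one_le_left (norm_nonneg _) (Nat.one_le_cast.2 n.succ_pos)
    _ ≤ (C + C) * ‖d‖ := by
        rwa [norm_div, norm_mul, Complex.norm_natCast, div_le_iff₀ hd0] at hdiff
    _ ≤ (C + C) * 2 := mul_le_mul_of_nonneg_left hd2 hC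
    _ = 4 * C := by ring

theorem exists_norm_jacobianMatrix_apply_le (h : IsBiholomorphism F G Ω (euclideanBall 0 1))
    (hΩ : IsOpen Ω) (hB : ConditionB Ω U) (hp : p ∈ U) (hFp : F p = 0) :
    ∃ M : ℝ, ∀ z ∈ Ω, ∀ i j, ‖jacobianMatrix F z i j‖ ≤ M := by
  obtain ⟨hU, -, hUΩ, C, -, hCK⟩ := hB
  have hball := (isOpen_euclideanBall (0 : Fin n → ℂ) 1).mem_nhds zero_mem_unitBall
  have hG0 : G 0 = p := hFp ▸ h.invOn.1 (hUΩ hp)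
  have hGU : G ⁻¹' U ∈ 𝓝 0 := (h.holomorphic_inv.continuousOn.continuousAt hball).preimage_mem_nhds
    (hG0.symm ▸ hU.mem_nhds hp)
  obtain ⟨δ, hδ, hmem⟩ := exists_ne_zero_forall_single_mem_of_mem_nhds_zero (inter_mem hGU hball)
  refine ⟨4 * C / ‖δ‖, fun z hz i j => ?_⟩
  have ht := (hmem i).1
  have hle := h.norm_fderiv_dotProduct_star_le hΩ (hUΩ hp) hFp (hUΩ ht) hz (hCK j z hz p hp)
    (hCK j z hz _ ht)
  rw [h.invOn.2 (hmem i).2, ← Pi.single_star, dotProduct_single, norm_mul, norm_star] at hle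
  exact (le_div_iff₀ (norm_pos_iff.2 hδ)).2 hle

theorem exists_pos_le_norm_complexJacobian (h : IsBiholomorphism F G Ω (euclideanBall 0 1))
    (hΩ : IsOpen Ω) (hp : p ∈ Ω) (hFp : F p = 0) {C : ℝ} (hC : 0 < C)
    (hCK : ∀ z ∈ Ω, C ≤ ‖bergmanKernel Ω z p‖) :
    ∃ c : ℝ, 0 < c ∧ ∀ z ∈ Ω, c ≤ ‖complexJacobian F z‖ := by
  have hV := volume_real_unitBall_pos (n := n)
  have hJp := norm_pos_iff.2 (h.complexJacobian_ne_zero hΩ (isOpen_euclideanBall 0 1) hp)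
  refine ⟨C * volume.real (euclideanBall (0 : Fin n → ℂ) 1) / ‖complexJacobian F p‖,
    by positivity, fun z hz => ?_⟩
  have hle := hCK z hz
  rwa [h.bergmanKernel_eq_of_unitBall hΩ hz hp, hFp, star_zero, dotProduct_zero, sub_zero, one_pow,
    inv_one, mul_one, norm_mul, norm_mul, norm_inv, Complex.norm_real, Real.norm_of_nonneg hV.le,
    RCLike.norm_conj, mul_assoc, le_inv_mul_iff₀' hV, ← div_le_iff₀ hJp] at hle

theorem exists_lipschitzOnWith_inv (h : IsBiholomorphism F G Ω (euclideanBall 0 1))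
    (hΩ : IsOpen Ω) {M c : ℝ} (hM : ∀ z ∈ Ω, ∀ i j, ‖jacobianMatrix F z i j‖ ≤ M) (hc : 0 < c)
    (hJ : ∀ z ∈ Ω, c ≤ ‖complexJacobian F z‖) :
    ∃ K, LipschitzOnWith K G (euclideanBall 0 1) := by
  have hB := isOpen_euclideanBall (0 : Fin n → ℂ) 1
  set R := c⁻¹ * ((Fintype.card (Fin n)).factorial * max M 1 ^ Fintype.card (Fin n))
  have hR : 0 ≤ R := by positivity
  have hentry : ∀ w ∈ euclideanBall (0 : Fin n → ℂ) 1, ∀ i j, ‖jacobianMatrix G w i j‖ ≤ R := by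
    intro w hw i j
    have hinv : jacobianMatrix G w = (jacobianMatrix F (G w))⁻¹ := by
      have hmul := h.jacobianMatrix_mul_jacobianMatrix hΩ hB (h.mapsTo_inv hw)
      rw [h.invOn.2 hw] at hmul
      exact (Matrix.inv_eq_left_inv hmul).symm
    rw [hinv]
    refine norm_matrix_inv_apply_le (le_max_right M 1) hc
      (fun i j => (hM _ (h.mapsTo_inv hw) i j).trans (le_max_left M 1)) ?_ i j
    rw [det_jacobianMatrix]
    exact hJ _ (h.mapsTo_inv hw)
  refine ⟨⟨Fintype.card (Fin n) * R, by positivity⟩,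
    (convex_euclideanBall 0 1).lipschitzOnWith_of_nnnorm_fderiv_le (𝕜 := ℂ)
      (fun w hw => h.symm.differentiableAt hB hw) fun w hw =>
        opNorm_le_card_mul_of_norm_apply_single_le hR fun j => ?_⟩
  exact (pi_norm_le_iff_of_nonneg hR).2 fun i => hentry w hw i j

theorem exists_continuous_inv (h : IsBiholomorphism F G Ω (euclideanBall 0 1))
    (hΩ : IsOpen Ω) (hB : ConditionB Ω U) (hp : p ∈ U) (hFp : F p = 0) {C : ℝ} (hC : 0 < C)
    (hCK : ∀ z ∈ Ω, C ≤ ‖bergmanKernel Ω z p‖) :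
    ∃ H, IsBiholomorphism F H Ω (euclideanBall 0 1) ∧ Continuous H := by
  obtain ⟨M, hM⟩ := h.exists_norm_jacobianMatrix_apply_le hΩ hB hp hFp
  obtain ⟨c, hc, hJ⟩ := h.exists_pos_le_norm_complexJacobian hΩ (hB.2.2.1 hp) hFp hC hCK
  obtain ⟨K, hK⟩ := h.exists_lipschitzOnWith_inv hΩ hM hc hJ
  obtain ⟨H, hH, hGH⟩ := hK.extend_finite_dimension
  exact ⟨H, h.congr (eqOn_refl F Ω) hGH.symm, hH.continuous⟩

end IsBiholomorphism

end BoundaryRegularity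

/-! ### Local connectedness of the boundary -/

section LocalConnectedness

theorem locallyConnectedSpace_image_of_isCompact {X Y : Type*} [TopologicalSpace X]
    [TopologicalSpace Y] [T2Space Y] {f : X → Y} {s : Set X} (hs : IsCompact s)
    (hf : ContinuousOn f s) [LocallyConnectedSpace s] : LocallyConnectedSpace (f '' s) := by
  have : CompactSpace s := isCompact_iff_compactSpace.1 hs
  have hcont : Continuous ((mapsTo_image f s).restrict f s (f '' s)) :=
    hf.mapsToRestrict (mapsTo_image f s)
  exact (hcont.isClosedMap.isQuotientMap hcont
    (surjective_mapsTo_image_restrict f s)).locallyConnectedSpace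

theorem locallyConnectedSpace_sphere {E : Type*} [NormedAddCommGroup E] [InnerProductSpace ℝ E]
    [FiniteDimensional ℝ E] [Nontrivial E] : LocallyConnectedSpace (sphere (0 : E) 1) := by
  obtain ⟨m, hm⟩ := Nat.exists_eq_add_one_of_ne_zero (Module.finrank_pos (R := ℝ) (M := E)).ne'
  have : Fact (Module.finrank ℝ E = m + 1) := ⟨hm⟩
  exact ChartedSpace.locallyConnectedSpace (EuclideanSpace ℝ (Fin m)) _

theorem image_frontier_eq_frontier {X Y : Type*} [TopologicalSpace X] [T2Space X]
    [TopologicalSpace Y] [T2Space Y] {f : X → Y} {g : Y → X} {A : Set X} {B : Set Y}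
    (hA : IsOpen A) (hB : IsOpen B) (hcpt : IsCompact (closure A))
    (hf : ContinuousOn f (closure A)) (hg : ContinuousOn g B) (hfAB : MapsTo f A B)
    (hgBA : MapsTo g B A) (hinv : InvOn g f A B) : f '' frontier A = frontier B := by
  have himage : f '' A = B := (hinv.2.surjOn hgBA).image_eq_of_mapsTo hfAB
  have hclosure : f '' closure A = closure B := by
    rw [image_closure_of_isCompact hcpt hf, himage]
  have hdisj : ∀ x ∈ frontier A, f x ∉ B := by
    intro x hx hfx
    have hxA : x ∈ closure A := frontier_subset_closure hx
    have : (𝓝[A] x).NeBot := mem_closure_iff_nhdsWithin_neBot.1 hxA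
    have hgf : Tendsto (g ∘ f) (𝓝[A] x) (𝓝 (g (f x))) :=
      (hg.continuousAt (hB.mem_nhds hfx)).tendsto.comp
        ((hf x hxA).mono subset_closure)
    have hid : Tendsto (g ∘ f) (𝓝[A] x) (𝓝 x) := (tendsto_id.mono_left nhdsWithin_le_nhds).congr'
      (eventuallyEq_nhdsWithin_of_eqOn fun _ hy => (hinv.1 hy).symm)
    rw [hA.frontier_eq] at hx
    exact hx.2 (tendsto_nhds_unique hgf hid ▸ hgBA hfx)
  apply Subset.antisymm
  · rintro _ ⟨x, hx, rfl⟩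
    rw [hB.frontier_eq, ← hclosure]
    exact ⟨mem_image_of_mem f (frontier_subset_closure hx), hdisj x hx⟩
  · rw [hB.frontier_eq, hA.frontier_eq, ← hclosure]
    rintro _ ⟨⟨x, hx, rfl⟩, hfx⟩
    exact ⟨x, ⟨hx, fun hxA => hfx (hfAB hxA)⟩, rfl⟩

variable {n : ℕ}

theorem frontier_unitBall : frontier (euclideanBall (0 : Fin n → ℂ) 1) =
    WithLp.ofLp '' sphere (0 : EuclideanSpace ℂ (Fin n)) 1 := by
  have hball : euclideanBall (0 : Fin n → ℂ) 1 =
      PiLp.homeomorph 2 (fun _ : Fin n => ℂ) '' ball (0 : EuclideanSpace ℂ (Fin n)) 1 := by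
    rw [Homeomorph.image_eq_preimage_symm, euclideanBall_eq_preimage, abs_one]
    rfl
  rw [hball, ← Homeomorph.image_frontier, frontier_ball _ one_ne_zero]
  rfl

theorem IsBiholomorphism.locallyConnectedSpace_frontier [NeZero n]
    {F H : (Fin n → ℂ) → (Fin n → ℂ)} {Ω : Set (Fin n → ℂ)}
    (h : IsBiholomorphism F H Ω (euclideanBall 0 1)) (hΩ : IsOpen Ω) (hH : Continuous H) :
    LocallyConnectedSpace (frontier Ω) := by
  have hfrontier : (H ∘ WithLp.ofLp) '' sphere (0 : EuclideanSpace ℂ (Fin n)) 1 = frontier Ω := by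
    rw [image_comp, ← frontier_unitBall]
    exact image_frontier_eq_frontier (isOpen_euclideanBall 0 1) hΩ
      (isBounded_euclideanBall 0 1).isCompact_closure hH.continuousOn h.holomorphic.continuousOn
      h.mapsTo_inv h.mapsTo h.symm.invOn
  have : LocallyConnectedSpace (sphere (0 : EuclideanSpace ℂ (Fin n)) 1) :=
    locallyConnectedSpace_sphere
  rw [← hfrontier]
  exact locallyConnectedSpace_image_of_isCompact (isCompact_sphere 0 1)
    (hH.comp (PiLp.continuous_ofLp 2 _)).continuousOn

end LocalConnectedness

theorem mainTheorem4 {n : ℕ} (hn : 1 ≤ n) (Ω U : Set (Fin n → ℂ))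
    (hopen : IsOpen Ω) (hconn : IsConnected Ω) (hbdd : Bornology.IsBounded Ω)
    (hball : ∃ (a : Fin n → ℂ) (r : ℝ), 0 < r ∧
      ∃ F G : (Fin n → ℂ) → (Fin n → ℂ), IsBiholomorphism F G Ω (euclideanBall a r))
    (hB : ConditionB Ω U)
    (hlower : ∃ C : ℝ, 0 < C ∧ ∀ z ∈ Ω, ∀ p ∈ U, C ≤ ‖bergmanKernel Ω z p‖) :
    (∀ p ∈ U, ∃ S : (Fin n → ℂ) → (Fin n → ℂ),
      IsBiholomorphism (bergmanRep Ω p) S Ω (bergmanBall Ω p) ∧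
      ContinuousOn S (closure (bergmanBall Ω p))) ∧
    LocallyConnectedSpace (frontier Ω) := by
  obtain ⟨a, r, hr, F₀, G₀, h₀⟩ := hball
  obtain ⟨C, hC, hCK⟩ := hlower
  have hext : ∀ p ∈ U, ∃ F H, IsBiholomorphism F H Ω (euclideanBall 0 1) ∧ F p = 0 ∧
      Continuous H := by
    intro p hp
    obtain ⟨F, G, h, hFp⟩ := h₀.exists_unitBall_apply_eq_zero hr (hB.2.2.1 hp)
    obtain ⟨H, hH, hHcont⟩ :=
      h.exists_continuous_inv hopen hB hp hFp hC fun z hz => hCK z hz p hp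
    exact ⟨F, H, hH, hFp, hHcont⟩
  refine ⟨fun p hp => ?_, ?_⟩
  · obtain ⟨F, H, h, hFp, hH⟩ := hext p hp
    exact ⟨H ∘ fderiv ℂ F p, h.isBiholomorphism_bergmanRep hopen (hB.2.2.1 hp) hFp,
      (hH.comp (fderiv ℂ F p).continuous).continuousOn⟩
  · have : NeZero n := ⟨Nat.one_le_iff_ne_zero.1 hn⟩
    obtain ⟨p, hp⟩ := hB.2.1
    obtain ⟨F, H, h, -, hH⟩ := hext p hp
    exact h.locallyConnectedSpace_frontier hopen hH
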